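/- Let $(N,g)$ be a complete smooth Riemannian manifold without boundary, let $M$ be a compact smooth manifold without boundary, and let $f:M\to N$ be a smooth embedding which is minimal, i.e. whose mean curvature vector $H_f=\operatorname{tr}_{f^*g}\mathrm{I\!I}_f$ vanishes identically. Let $TM^\perp\to M$ be the normal bundle of $f$, whose fibre $T_xM^\perp$ over $x$ is the orthogonal complement of $df(T_xM)$ in $T_{f(x)}N$, and suppose that the normal exponential map $\exp^\perp:TM^\perp\to N$, $\exp^\perp(x,v)=\exp_{f(x)}(v)$, is a diffeomorphism. By the fibres of $\exp^\perp$ we mean the submanifolds $\exp^\perp(T_xM^\perp)$, $x\in M$, of $N$. For an open set $U\subset M$, a smooth section $\eta$ of $TM^\perp$ over $U$ of unit length and a constant $r>0$, put $\varphi_r=\exp^\perp(r\eta):U\to N$, and let $v_r$ be the volume form of the metric $\varphi_r^*g$ on $U$ (for any local orientation). Suppose that $\frac{dv_r}{dr}>0$ at every point of $U$, for all $r>0$ and for every such $U$ and $\eta$; that is, $\frac{d}{dr}\,v_r(e_1,\dots,e_m)>0$ for every positively oriented basis $(e_1,\dots,e_m)$ of a tangent space of $U$. Then $f$ is, up to reparametrisation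 of $M$, the unique minimal immersion of $M$ which is transverse to the fibres of $\exp^\perp$. Precisely: $f$ is a minimal immersion transverse to the fibres of $\exp^\perp$; and if $\psi:M\to N$ is any smooth minimal immersion transverse to the fibres of $\exp^\perp$, i.e. such that for every $y\in M$ the space $d\psi(T_yM)$ and the tangent space at $\psi(y)$ of the fibre through $\psi(y)$ together span $T_{\psi(y)}N$, then $\psi=f\circ\alpha$ for a local diffeomorphism $\alpha:M\to M$. If $M$ is connected, then $\alpha$ is surjective (so that $\psi(M)=f(M)$), and if $\psi$ is injective, then $\alpha$ is a diffeomorphism. -/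

import Mathlib

open Manifold Bundle
open scoped ContDiff Topology

noncomputable section

namespace NormalExp

/-! ### Levi-Civita connection and geodesics of a Riemannian manifold, in charts -/

section Ambient

variable (n : ℕ) {N : Type*} [TopologicalSpace N] [ChartedSpace (EuclideanSpace ℝ (Fin n)) N]

/-- The `i`-th coordinate vector field of the chart centred at `p`, at the point of coordinates
`y`. -/
def coordFrame (p : N) (y : EuclideanSpace ℝ (Fin n)) (i : Fin n) :
    TangentSpace (𝓡 n) ((extChartAt (𝓡 n) p).symm y) :=
  mfderiv (𝓡 n) (𝓡 n) (extChartAt (𝓡 n) p).symm y (EuclideanSpace.single i (1 : ℝ))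

variable [IsManifold (𝓡 n) ∞ N] [RiemannianBundle (fun x : N ↦ TangentSpace (𝓡 n) x)]

/-- The matrix `g_{ij}` of the Riemannian metric in the chart centred at `p`. -/
def coordMetric (p : N) (y : EuclideanSpace ℝ (Fin n)) : Matrix (Fin n) (Fin n) ℝ :=
  Matrix.of fun i j ↦ inner ℝ (coordFrame n p y i) (coordFrame n p y j)

/-- The coordinate derivative `∂_k g_{ij}`. -/
def coordMetricDeriv (p : N) (y : EuclideanSpace ℝ (Fin n)) (k i j : Fin n) : ℝ :=
  fderiv ℝ (fun z ↦ coordMetric n p z i j) y (EuclideanSpace.single k (1 : ℝ))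

/-- The Christoffel symbols `Γ^k_{ij} = ½ g^{kl} (∂_i g_{jl} + ∂_j g_{il} - ∂_l g_{ij})` of the
Levi-Civita connection in the chart centred at `p`. -/
def christoffel (p : N) (y : EuclideanSpace ℝ (Fin n)) (k i j : Fin n) : ℝ :=
  (1 / 2) * ∑ l, (coordMetric n p y)⁻¹ k l *
    (coordMetricDeriv n p y i j l + coordMetricDeriv n p y j i l - coordMetricDeriv n p y l i j)

/-- The vector `Γ(v, w)` of components `Γ^k_{ij} v^i w^j` in the chart centred at `p`. -/
def christoffelForm (p : N) (y v w : EuclideanSpace ℝ (Fin n)) : EuclideanSpace ℝ (Fin n) :=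
  WithLp.toLp 2 fun k ↦ ∑ i, ∑ j, christoffel n p y k i j * v i * w j

/-- A complete (i.e. defined on the whole of `ℝ`) geodesic: a smooth curve which satisfies
`c'' + Γ(c', c') = 0` in every chart. -/
def IsGeodesic (γ : ℝ → N) : Prop :=
  ContMDiff 𝓘(ℝ, ℝ) (𝓡 n) ∞ γ ∧
  ∀ (p : N) (t : ℝ), γ t ∈ (chartAt (EuclideanSpace ℝ (Fin n)) p).source →
    deriv (deriv fun s ↦ extChartAt (𝓡 n) p (γ s)) t
      + christoffelForm n p (extChartAt (𝓡 n) p (γ t))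
          (deriv (fun s ↦ extChartAt (𝓡 n) p (γ s)) t)
          (deriv (fun s ↦ extChartAt (𝓡 n) p (γ s)) t) = 0

/-- The velocity `(γ t, γ' t)` of a curve, as a point of the tangent bundle. -/
def velocity (γ : ℝ → N) (t : ℝ) : TangentBundle (𝓡 n) N :=
  ⟨γ t, mfderiv 𝓘(ℝ, ℝ) (𝓡 n) γ t (1 : ℝ)⟩

/-- The tangent vectors that are the initial velocity of a complete geodesic; in a complete
manifold these are all tangent vectors. -/
def expDomain : Set (TangentBundle (𝓡 n) N) :=
  {V | ∃ γ : ℝ → N, IsGeodesic n γ ∧ velocity n γ 0 = V}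

open Classical in
/-- The exponential map: `exp V = γ 1`, where `γ` is the geodesic of initial velocity `V` (and,
by convention, the foot point of `V` if there is none). -/
def expMap (V : TangentBundle (𝓡 n) N) : N :=
  if h : ∃ γ : ℝ → N, IsGeodesic n γ ∧ velocity n γ 0 = V then h.choose 1 else V.proj

end Ambient

/-! ### Geometry of a map `φ : M → N` into a Riemannian manifold -/

section Maps

variable (m n : ℕ)
  {M : Type*} [TopologicalSpace M] [ChartedSpace (EuclideanSpace ℝ (Fin m)) M]
  {N : Type*} [TopologicalSpace N] [ChartedSpace (EuclideanSpace ℝ (Fin n)) N] [IsManifold (𝓡 n) ∞ N]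
  [RiemannianBundle (fun x : N ↦ TangentSpace (𝓡 n) x)]

/-- The normal space `T_xM^⊥ = (dφ (T_x M))^⊥ ⊆ T_{φ x} N`. -/
def normalSpace (φ : M → N) (x : M) : Submodule ℝ (TangentSpace (𝓡 n) (φ x)) :=
  (LinearMap.range (mfderiv (𝓡 m) (𝓡 n) φ x).toLinearMap)ᗮ

/-- The Gram matrix `(φ^* g)_x (e_i, e_j)` of a family of tangent vectors to `M` at `x` for the
pulled back metric. -/
def inducedGram (φ : M → N) (x : M) (e : Fin m → TangentSpace (𝓡 m) x) :
    Matrix (Fin m) (Fin m) ℝ :=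
  Matrix.of fun i j ↦
    inner ℝ (mfderiv (𝓡 m) (𝓡 n) φ x (e i)) (mfderiv (𝓡 m) (𝓡 n) φ x (e j))

/-- The value of the volume form of the metric `φ^* g` on a (positively oriented) basis `e` of
`T_x M`. -/
def volumeForm (φ : M → N) (x : M) (e : Fin m → TangentSpace (𝓡 m) x) : ℝ :=
  √(inducedGram m n φ x e).det

/-- The map `φ` read in the preferred charts at `x` and at `φ x`. -/
def readInCharts (φ : M → N) (x : M) : EuclideanSpace ℝ (Fin m) → EuclideanSpace ℝ (Fin n) :=
  fun y ↦ extChartAt (𝓡 n) (φ x) (φ ((extChartAt (𝓡 m) x).symm y))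

/-- The vector `∂_v ∂_w φ + Γ(∂_v φ, ∂_w φ)`, i.e. the covariant derivative in direction `v` of the
vector field along `φ` which is the image under `dφ` of the coordinate field extending `w`. All is
computed in the preferred charts at `x` and `φ x`, through which Mathlib identifies the tangent
spaces `T_x M` and `T_{φ x} N` with the model spaces. -/
def covariantHessian (φ : M → N) (x : M) (v w : TangentSpace (𝓡 m) x) :
    TangentSpace (𝓡 n) (φ x) :=
  letI F := readInCharts m n φ x
  letI a : EuclideanSpace ℝ (Fin m) := extChartAt (𝓡 m) x x
  letI v' : EuclideanSpace ℝ (Fin m) := v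
  letI w' : EuclideanSpace ℝ (Fin m) := w
  (fderiv ℝ (fderiv ℝ F) a v' w'
    + christoffelForm n (φ x) (extChartAt (𝓡 n) (φ x) (φ x)) (fderiv ℝ F a v') (fderiv ℝ F a w') :
    EuclideanSpace ℝ (Fin n))

/-- The second fundamental form of an immersion: the normal component of the covariant
derivative. -/
def secondFundamentalForm (φ : M → N) (x : M) (v w : TangentSpace (𝓡 m) x) :
    TangentSpace (𝓡 n) (φ x) :=
  haveI : FiniteDimensional ℝ (TangentSpace (𝓡 n) (φ x)) :=
    inferInstanceAs (FiniteDimensional ℝ (EuclideanSpace ℝ (Fin n)))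
  (normalSpace m n φ x).starProjection (covariantHessian m n φ x v w)

/-- The standard basis of `T_x M` given by the preferred chart at `x`. -/
def stdFrame (x : M) (i : Fin m) : TangentSpace (𝓡 m) x :=
  (EuclideanSpace.single i (1 : ℝ) : EuclideanSpace ℝ (Fin m))

/-- The mean curvature vector `H_φ = tr_γ II = γ^{ij} II(∂_i, ∂_j)`, where `γ = φ^* g`. -/
def meanCurvature (φ : M → N) (x : M) : TangentSpace (𝓡 n) (φ x) :=
  ∑ i, ∑ j, (inducedGram m n φ x (stdFrame m x))⁻¹ i j •
    secondFundamentalForm m n φ x (stdFrame m x i) (stdFrame m x j)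

/-- A minimal immersion: a smooth immersion of vanishing mean curvature. -/
structure IsMinimalImmersion (φ : M → N) : Prop where
  isImmersion : IsImmersion (𝓡 m) (𝓡 n) ∞ φ
  meanCurvature_eq_zero : ∀ x, meanCurvature m n φ x = 0

/-! ### The normal exponential map -/

/-- The total space of the normal bundle `TM^⊥` of `f : M → N`, realised as the set of the
`(x, (f x, v))` in `M × TN` with `v` normal to `f` at `x`. For an immersion `f` this is an embedded
submanifold of `M × TN`, which is the manifold structure of `TM^⊥`. -/
def normalBundle (f : M → N) : Set (M × TangentBundle (𝓡 n) N) :=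
  {P | ∃ x : M, ∃ v ∈ normalSpace m n f x, P = (x, ⟨f x, v⟩)}

/-- The normal exponential map `exp^⊥ : TM^⊥ → N` is (defined on the whole of `TM^⊥` and) a
diffeomorphism: it is smooth on the embedded submanifold `TM^⊥` of `M × TN`, and it has a two-sided
inverse `N → TM^⊥` which is smooth, as a map into `M × TN`. -/
structure NormalExpIsDiffeo (f : M → N) : Prop where
  defined : ∀ P ∈ normalBundle m n f, P.2 ∈ expDomain n
  smooth : ContMDiffOn ((𝓡 m).prod (𝓡 n).tangent) (𝓡 n) ∞
    (fun P : M × TangentBundle (𝓡 n) N ↦ expMap n P.2) (normalBundle m n f)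
  exists_inverse : ∃ σ : N → M × TangentBundle (𝓡 n) N,
    ContMDiff (𝓡 n) ((𝓡 m).prod (𝓡 n).tangent) ∞ σ ∧
    (∀ q, σ q ∈ normalBundle m n f) ∧
    (∀ q, expMap n (σ q).2 = q) ∧
    (∀ P ∈ normalBundle m n f, σ (expMap n P.2) = P)

/-- The pushoff `φ_r = exp^⊥ (r η)` of `f` along a section `η` of the normal bundle. -/
def pushoff (f : M → N) (η : (x : M) → TangentSpace (𝓡 n) (f x)) (r : ℝ) (x : M) : N :=
  expMap n ⟨f x, r • η x⟩

/-- `η` is, on the open set `U`, a smooth section of `TM^⊥` of unit length. -/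
structure IsUnitNormalOn (f : M → N) (U : Set M) (η : (x : M) → TangentSpace (𝓡 n) (f x)) :
    Prop where
  isOpen : IsOpen U
  smooth : ContMDiffOn (𝓡 m) (𝓡 n).tangent ∞
    (fun x ↦ (⟨f x, η x⟩ : TangentBundle (𝓡 n) N)) U
  normal : ∀ x ∈ U, η x ∈ normalSpace m n f x
  unit : ∀ x ∈ U, ‖η x‖ = 1

/-- `dv_r/dr > 0` for all `r > 0` and all local unit normal sections `η`, where `v_r` is the volume
form of `φ_r^* g`: the derivative in `r` of `v_r`, evaluated on any basis of `T_x M`, is positive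
(`v_r` is positive on that basis for the orientation which the basis defines). -/
def VolumeStrictlyIncreasing (f : M → N) : Prop :=
  ∀ (U : Set M) (η : (x : M) → TangentSpace (𝓡 n) (f x)), IsUnitNormalOn m n f U η →
    ∀ x ∈ U, ∀ (e : Module.Basis (Fin m) ℝ (TangentSpace (𝓡 m) x)) (r : ℝ), 0 < r →
      0 < deriv (fun s ↦ volumeForm m n (pushoff n f η s) x e) r

/-- The tangent space at `q` to the fibre of `exp^⊥` through `q`, i.e. to the submanifold
`exp^⊥ (T_x M^⊥)` which contains `q`: it is spanned by the velocities at `q` of the curves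
`t ↦ exp^⊥ (v + t w)` with `v, w ∈ T_x M^⊥` and `exp^⊥ v = q`. -/
def fibreTangentSpace (f : M → N) (q : N) : Submodule ℝ (TangentSpace (𝓡 n) q) :=
  Submodule.span ℝ {u | ∃ x : M, ∃ v ∈ normalSpace m n f x, ∃ w ∈ normalSpace m n f x,
    velocity n (fun t : ℝ ↦ expMap n (⟨f x, v + t • w⟩ : TangentBundle (𝓡 n) N)) 0 = ⟨q, u⟩}

/-- `ψ` is transverse to the fibres of the normal exponential map of `f`. -/
def TransverseToFibres (f ψ : M → N) : Prop :=
  ∀ y : M, LinearMap.range (mfderiv (𝓡 m) (𝓡 n) ψ y).toLinearMap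
    ⊔ fibreTangentSpace m n f (ψ y) = ⊤

end Maps

end NormalExp

end

/-! The argument is a maximum principle for the distance to `f` along the fibres. Let `σ` be the
inverse of `exp^⊥`, let `τ` be its component in `M` (the projection of `N` along the fibres), and
put `α = τ ∘ ψ`. The differential of `τ` is onto and kills the tangent spaces of the fibres, so
transversality of `ψ` makes `dα` onto. Since the dimensions agree, `α` is a local diffeomorphism
(`isLocalDiffeomorph_fst_comp`).

Let `ρ` be the length of the normal vector `σ (ψ y)`. By compactness `ρ²` has a maximum, at `y` say;
suppose it is positive. Near `y` the map `ψ` is a graph `z ↦ Φ (ρ z, z)`, where `Φ (r, ·)` is the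
pushoff of `f` at distance `r` along the unit normal direction of `ψ`, composed with `α`. By the
Gauss lemma (`gauss`) the radial velocity `T = ∂_r Φ` is orthogonal to every slice `Φ (r, ·)`. By
the first variation formula (`fderiv_inducedForm_radial`) the `r`-derivative of the induced metric
is `-2 ⟨∇dΦ, T⟩`, so `dv_r/dr > 0` says that the mean curvature of the slice has negative product
with `T`.

At the maximum `dρ = 0`, so the graph is tangent to the slice `r = ρ y` and induces the same metric
there, while its covariant Hessian differs by `Hess ρ • T` with `Hess ρ ≤ 0`. Hence `⟨H_ψ, T⟩ < 0`
(`exists_normal_of_deriv_volume_pos`), against minimality. As the volume inequality is strict, no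
strong maximum principle is needed, and testing `H_ψ` against the single normal `T` suffices in any
codimension. Thus `ρ` vanishes identically, that is `ψ = f ∘ α`.

Surjectivity of `α` is topological: it is an open map of a compact Hausdorff space to itself. -/

set_option linter.unusedSectionVars false

noncomputable section

namespace NormalExp

/-! ### Calculus in normed spaces: pullbacks of forms, graphs, Hessians at a maximum -/

section Calculus

variable {X E : Type*} [NormedAddCommGroup X] [NormedSpace ℝ X]
  [NormedAddCommGroup E] [NormedSpace ℝ E]

set_option synthInstance.maxHeartbeats 200000 in
/-- Derivative of the coefficients of a pulled back bilinear form, in terms of a compatible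
connection. -/
lemma fderiv_pullback_form {G : E → E →L[ℝ] E →L[ℝ] ℝ} {Γ : E → E → E} {F : X → E} {x : X}
    (hF : ContDiffAt ℝ 2 F x) (hG : DifferentiableAt ℝ G (F x))
    (hΓ : ∀ u v w, fderiv ℝ G (F x) u v w = G (F x) (Γ u v) w + G (F x) v (Γ u w)) (u v w : X) :
    fderiv ℝ (fun z ↦ G (F z) (fderiv ℝ F z u) (fderiv ℝ F z v)) x w =
      G (F x) (fderiv ℝ (fderiv ℝ F) x w u + Γ (fderiv ℝ F x w) (fderiv ℝ F x u)) (fderiv ℝ F x v)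
      + G (F x) (fderiv ℝ F x u)
        (fderiv ℝ (fderiv ℝ F) x w v + Γ (fderiv ℝ F x w) (fderiv ℝ F x v)) := by
  have h1 : HasFDerivAt F (fderiv ℝ F x) x :=
    (hF.differentiableAt (by norm_num)).hasFDerivAt
  have h2 : HasFDerivAt (fderiv ℝ F) (fderiv ℝ (fderiv ℝ F) x) x :=
    ((hF.fderiv_right (m := 1) (by norm_num)).differentiableAt (by norm_num)).hasFDerivAt
  have h3 : HasFDerivAt (fun z ↦ G (F z)) ((fderiv ℝ G (F x)).comp (fderiv ℝ F x)) x :=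
    HasFDerivAt.comp (g := G) (f := F) x hG.hasFDerivAt h1
  have hu : ∀ u : X, HasFDerivAt (fun z ↦ fderiv ℝ F z u) ((fderiv ℝ (fderiv ℝ F) x).flip u) x :=
    fun u ↦ by simpa using h2.clm_apply (hasFDerivAt_const u x)
  rw [((h3.clm_apply (hu u)).clm_apply (hu v)).fderiv]
  simp [hΓ]
  abel

set_option synthInstance.maxHeartbeats 200000 in
lemma differentiableAt_pullback_form {G : E → E →L[ℝ] E →L[ℝ] ℝ} {F : X → E} {x : X}
    (hF : ContDiffAt ℝ 2 F x) (hG : DifferentiableAt ℝ G (F x)) (u v : X) :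
    DifferentiableAt ℝ (fun z ↦ G (F z) (fderiv ℝ F z u) (fderiv ℝ F z v)) x := by
  have h2 : DifferentiableAt ℝ (fderiv ℝ F) x :=
    (hF.fderiv_right (m := 1) (by norm_num)).differentiableAt (by norm_num)
  have h3 : DifferentiableAt ℝ (fun z ↦ G (F z)) x :=
    DifferentiableAt.comp (g := G) (f := F) x hG (hF.differentiableAt (by norm_num))
  exact (h3.clm_apply (h2.clm_apply (differentiableAt_const u))).clm_apply
    (h2.clm_apply (differentiableAt_const v))

/-- First and second derivatives along the first factor. -/
lemma deriv_fst_slice {F : ℝ × X → E} {r : ℝ} {a : X} (hF : ContDiffAt ℝ 2 F (r, a)) :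
    deriv (fun s ↦ F (s, a)) r = fderiv ℝ F (r, a) (1, 0) ∧
    deriv (deriv fun s ↦ F (s, a)) r = fderiv ℝ (fderiv ℝ F) (r, a) (1, 0) (1, 0) := by
  have hl : ∀ s : ℝ, HasDerivAt (fun s : ℝ ↦ (s, a)) ((1 : ℝ), (0 : X)) s := fun s ↦
    (hasDerivAt_id s).prodMk (hasDerivAt_const s a)
  have hd : ∀ᶠ s in 𝓝 r, deriv (fun s ↦ F (s, a)) s = fderiv ℝ F (s, a) (1, 0) := by
    filter_upwards [(hl r).continuousAt.eventually (hF.eventually (by simp))] with s hs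
    exact (HasFDerivAt.comp_hasDerivAt (l := F) (f := fun s : ℝ ↦ (s, a)) s
      (hs.differentiableAt (by norm_num)).hasFDerivAt (hl s)).deriv
  refine ⟨hd.self_of_nhds, ?_⟩
  rw [Filter.EventuallyEq.deriv_eq hd]
  have h2 : HasFDerivAt (fderiv ℝ F) (fderiv ℝ (fderiv ℝ F) (r, a)) (r, a) :=
    ((hF.fderiv_right (m := 1) (by norm_num)).differentiableAt (by norm_num)).hasFDerivAt
  have := (HasFDerivAt.comp_hasDerivAt (l := fderiv ℝ F) (f := fun s : ℝ ↦ (s, a)) r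
    h2 (hl r)).clm_apply (hasDerivAt_const r ((1 : ℝ), (0 : X)))
  simpa using this.deriv

/-- First and second derivatives of `z ↦ F (ρ z, z)` at a critical point of `ρ`. -/
lemma fderiv_graph {F : ℝ × X → E} {ρ : X → ℝ} {a : X}
    (hF : ContDiffAt ℝ 2 F (ρ a, a)) (hρ : ContDiffAt ℝ 2 ρ a) (h0 : fderiv ℝ ρ a = 0) (v w : X) :
    fderiv ℝ (fun z ↦ F (ρ z, z)) a w = fderiv ℝ F (ρ a, a) (0, w) ∧
    fderiv ℝ (fderiv ℝ (fun z ↦ F (ρ z, z))) a v w =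
      fderiv ℝ (fderiv ℝ F) (ρ a, a) (0, v) (0, w)
        + fderiv ℝ (fderiv ℝ ρ) a v w • fderiv ℝ F (ρ a, a) (1, 0) := by
  have hcont : ContinuousAt (fun z ↦ (ρ z, z)) a := hρ.continuousAt.prodMk continuousAt_id
  have hd : ∀ᶠ z in 𝓝 a, fderiv ℝ (fun z ↦ F (ρ z, z)) z =
      (fderiv ℝ F (ρ z, z)).comp ((fderiv ℝ ρ z).prod (ContinuousLinearMap.id ℝ X)) := by
    filter_upwards [hρ.eventually (by simp), hcont.eventually (hF.eventually (by simp))]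
      with z hz hz'
    have h1 : HasFDerivAt (fun z ↦ (ρ z, z)) ((fderiv ℝ ρ z).prod (ContinuousLinearMap.id ℝ X)) z :=
      (hz.differentiableAt (by norm_num)).hasFDerivAt.prodMk (hasFDerivAt_id z)
    exact (HasFDerivAt.comp (g := F) (f := fun z ↦ (ρ z, z)) z
      (hz'.differentiableAt (by norm_num)).hasFDerivAt h1).fderiv
  have h1 : HasFDerivAt (fun z ↦ (ρ z, z)) ((fderiv ℝ ρ a).prod (ContinuousLinearMap.id ℝ X)) a :=
      (hρ.differentiableAt (by norm_num)).hasFDerivAt.prodMk (hasFDerivAt_id a)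
  have h2 : HasFDerivAt (fderiv ℝ F) (fderiv ℝ (fderiv ℝ F) (ρ a, a)) (ρ a, a) :=
    ((hF.fderiv_right (m := 1) (by norm_num)).differentiableAt (by norm_num)).hasFDerivAt
  have h3 : HasFDerivAt (fderiv ℝ ρ) (fderiv ℝ (fderiv ℝ ρ) a) a :=
    ((hρ.fderiv_right (m := 1) (by norm_num)).differentiableAt (by norm_num)).hasFDerivAt
  refine ⟨by rw [hd.self_of_nhds]; simp [h0], ?_⟩
  have h4 : HasFDerivAt (fun z ↦ fderiv ℝ (fun z ↦ F (ρ z, z)) z w)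
      ((fderiv ℝ F (ρ a, a)).comp (((fderiv ℝ (fderiv ℝ ρ) a).flip w).prod 0) +
        ((fderiv ℝ (fderiv ℝ F) (ρ a, a)).comp
          ((fderiv ℝ ρ a).prod (ContinuousLinearMap.id ℝ X))).flip (fderiv ℝ ρ a w, w)) a := by
    have h5 := (HasFDerivAt.comp (g := fderiv ℝ F) (f := fun z ↦ (ρ z, z)) a h2 h1).clm_apply
      ((h3.clm_apply (hasFDerivAt_const w a)).prodMk (hasFDerivAt_const w a))
    refine (h5.congr_of_eventuallyEq ?_).congr_fderiv ?_
    · filter_upwards [hd] with z hz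
      rw [hz]; rfl
    · ext v; simp
  have h6 : HasFDerivAt (fderiv ℝ (fun z ↦ F (ρ z, z)))
      (fderiv ℝ (fderiv ℝ (fun z ↦ F (ρ z, z))) a) a := by
    have : ContDiffAt ℝ 2 (fun z ↦ F (ρ z, z)) a :=
      ContDiffAt.comp (g := F) (f := fun z ↦ (ρ z, z)) a hF (hρ.prodMk contDiffAt_id)
    exact ((this.fderiv_right (m := 1) (by norm_num)).differentiableAt (by norm_num)).hasFDerivAt
  have h7 := (h6.clm_apply (hasFDerivAt_const w a)).unique h4
  have h8 := congrArg (fun L : X →L[ℝ] E ↦ L v) h7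
  -- Every term containing `dρ` drops out; the only trace of `ρ` left is its Hessian times the
  -- derivative of `F` in the first variable.
  simp only [h0] at h8
  have h9 : ((fderiv ℝ (fderiv ℝ ρ) a v w, 0) : ℝ × X) =
      fderiv ℝ (fderiv ℝ ρ) a v w • ((1, 0) : ℝ × X) := by simp
  simp at h8
  rw [h8, h9, map_smul, add_comm]

/-- The Hessian at a local maximum is negative semidefinite. -/
lemma fderiv_fderiv_nonpos_of_isLocalMax {ρ : X → ℝ} {a : X} (h : IsLocalMax ρ a)
    (hρ : ContDiffAt ℝ 2 ρ a) (v : X) : fderiv ℝ (fderiv ℝ ρ) a v v ≤ 0 := by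
  by_contra! hpos
  set c : ℝ → ℝ := fun t ↦ ρ (a + t • v) with hc
  have hl : ∀ t : ℝ, HasDerivAt (fun t : ℝ ↦ a + t • v) v t := fun t ↦ by
    simpa using ((hasDerivAt_id t).smul_const v).const_add a
  have hcont : ContinuousAt (fun t : ℝ ↦ a + t • v) 0 := (hl 0).continuousAt
  have ha : a + (0 : ℝ) • v = a := by simp
  have hcont' : Filter.Tendsto (fun t : ℝ ↦ a + t • v) (𝓝 0) (𝓝 a) := by
    simpa [ContinuousAt] using hcont
  have hd : ∀ᶠ t in 𝓝 (0 : ℝ), deriv c t = fderiv ℝ ρ (a + t • v) v := by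
    filter_upwards [hcont'.eventually (hρ.eventually (by simp))] with t ht
    exact (HasFDerivAt.comp_hasDerivAt (l := ρ) (f := fun t : ℝ ↦ a + t • v) t
      (ht.differentiableAt (by norm_num)).hasFDerivAt (hl t)).deriv
  have h2 : HasFDerivAt (fderiv ℝ ρ) (fderiv ℝ (fderiv ℝ ρ) a) (a + (0 : ℝ) • v) := by
    rw [ha]
    exact ((hρ.fderiv_right (m := 1) (by norm_num)).differentiableAt (by norm_num)).hasFDerivAt
  have hdd : deriv (deriv c) 0 = fderiv ℝ (fderiv ℝ ρ) a v v := by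
    rw [Filter.EventuallyEq.deriv_eq hd]
    have := (HasFDerivAt.comp_hasDerivAt (l := fderiv ℝ ρ) (f := fun t : ℝ ↦ a + t • v) 0
      h2 (hl 0)).clm_apply (hasDerivAt_const (0 : ℝ) v)
    simpa using this.deriv
  have hmax : IsLocalMax c 0 := by
    have := hcont'.eventually h
    filter_upwards [this] with t ht
    simpa [hc] using ht
  have hc0 : ContinuousAt c 0 := by
    refine ContinuousAt.comp (g := ρ) ?_ hcont
    rw [ha]; exact hρ.continuousAt
  -- A positive second derivative would make the maximum a minimum as well, hence `c` locally
  -- constant with zero second derivative.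
  have hmin := isLocalMin_of_deriv_deriv_pos (hdd ▸ hpos) hmax.deriv_eq_zero hc0
  have hconst : c =ᶠ[𝓝 0] fun _ ↦ c 0 := by
    filter_upwards [hmax, hmin] with t h1 h2 using le_antisymm h1 h2
  have h3 : deriv c =ᶠ[𝓝 0] fun _ ↦ 0 := by
    filter_upwards [hconst.deriv] with t ht
    simpa using ht
  rw [← hdd, h3.deriv_eq] at hpos
  simp at hpos

end Calculus

/-! ### Determinants and contractions of matrices -/

section Matrices

variable {ι : Type*} [Fintype ι] [DecidableEq ι]

/-- Jacobi's formula. -/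
lemma hasDerivAt_det {A : ℝ → Matrix ι ι ℝ} {A' : Matrix ι ι ℝ} {r : ℝ}
    (h : ∀ i j, HasDerivAt (fun s ↦ A s i j) (A' i j) r) :
    HasDerivAt (fun s ↦ (A s).det) (∑ i, ∑ j, A' i j * (A r).adjugate j i) r := by
  have hA : HasDerivAt (fun s i ↦ A s i) (fun i ↦ A' i) r :=
    hasDerivAt_pi.2 fun i ↦ hasDerivAt_pi.2 fun j ↦ h i j
  let D : ContinuousMultilinearMap ℝ (fun _ : ι ↦ ι → ℝ) ℝ :=
    ⟨(Matrix.detRowAlternating (n := ι) (R := ℝ)).toMultilinearMap,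
      (continuous_id (X := Matrix ι ι ℝ)).matrix_det⟩
  have := (D.hasFDerivAt (fun i ↦ A r i)).comp_hasDerivAt r hA
  refine this.congr_deriv ?_
  rw [ContinuousMultilinearMap.linearDeriv_apply]
  refine Finset.sum_congr rfl fun i _ ↦ ?_
  -- The cofactors of row `i` do not involve row `i`, so replacing that row leaves them unchanged.
  have hadj : ∀ j, (A r).adjugate j i = ((A r).updateRow i (A' i)).adjugate j i := fun j ↦ by
    simp [Matrix.adjugate_apply, Matrix.updateRow_idem]
  calc D (Function.update (fun i ↦ A r i) i (A' i)) = ((A r).updateRow i (A' i)).det := rfl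
    _ = _ := by
      rw [Matrix.det_eq_sum_mul_adjugate_row _ i]
      simp [← hadj]

/-- If the square root of a Gram determinant increases, so does its logarithm. -/
lemma sum_inv_mul_pos_of_deriv_sqrt_det_pos {A : ℝ → Matrix ι ι ℝ} {A' : Matrix ι ι ℝ} {r : ℝ}
    (h : ∀ i j, HasDerivAt (fun s ↦ A s i j) (A' i j) r) (hps : (A r).PosSemidef)
    (hpos : 0 < deriv (fun s ↦ √(A s).det) r) :
    0 < ∑ i, ∑ j, (A r)⁻¹ i j * A' j i := by
  have hdet : (A r).det ≠ 0 := by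
    intro h0
    -- A vanishing determinant would put `√det` at its absolute minimum `0`. There `deriv` is `0`,
    -- either by Fermat or by its default value where the derivative fails to exist.
    have hmin : IsLocalMin (fun s ↦ √(A s).det) r := by
      refine Filter.Eventually.of_forall fun s ↦ ?_
      simp [h0]
    exact hpos.ne' hmin.deriv_eq_zero
  have hdet' : 0 < (A r).det := lt_of_le_of_ne hps.det_nonneg hdet.symm
  rw [((hasDerivAt_det h).sqrt hdet).deriv] at hpos
  have h1 : ∑ i, ∑ j, (A r)⁻¹ i j * A' j i =
      (A r).det⁻¹ * ∑ i, ∑ j, A' i j * (A r).adjugate j i := by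
    rw [Finset.sum_comm, Finset.mul_sum]
    refine Finset.sum_congr rfl fun i _ ↦ ?_
    rw [Finset.mul_sum]
    refine Finset.sum_congr rfl fun j _ ↦ ?_
    rw [Matrix.inv_def]
    simp
    ring
  rw [h1]
  refine mul_pos (inv_pos.2 hdet') ?_
  exact (div_pos_iff_of_pos_right (by positivity)).1 hpos

/-- The contraction of a positive definite matrix with a negative semidefinite form. -/
lemma sum_posSemidef_mul_nonpos {B : Matrix ι ι ℝ} (hB : B.PosSemidef)
    {E : Type*} [AddCommGroup E] [Module ℝ E] (q : E →ₗ[ℝ] E →ₗ[ℝ] ℝ) (hq : ∀ v, q v v ≤ 0)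
    (e : ι → E) : ∑ i, ∑ j, B i j * q (e i) (e j) ≤ 0 := by
  -- Factoring `B = Cᵀ C` turns the contraction into a sum of values of `q` on the diagonal.
  obtain ⟨C, rfl⟩ : ∃ C : Matrix ι ι ℝ, B = C.conjTranspose * C := by
    open scoped MatrixOrder in
    exact CStarAlgebra.nonneg_iff_eq_star_mul_self.1 hB.nonneg
  have : ∑ i, ∑ j, (C.conjTranspose * C) i j * q (e i) (e j) =
      ∑ k, q (∑ i, C k i • e i) (∑ j, C k j • e j) := by
    simp only [map_sum, LinearMap.sum_apply, map_smul, LinearMap.smul_apply, Matrix.mul_apply,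
      Matrix.conjTranspose_apply, Finset.sum_mul, smul_eq_mul, star_trivial]
    rw [Finset.sum_comm]
    conv_rhs => rw [Finset.sum_comm]
    refine Finset.sum_congr rfl fun i _ ↦ ?_
    simp only [Finset.mul_sum]
    conv_rhs => rw [Finset.sum_comm]
    refine Finset.sum_congr rfl fun j _ ↦ Finset.sum_congr rfl fun k _ ↦ ?_
    ring
  rw [this]
  exact Finset.sum_nonpos fun k _ ↦ hq _

end Matrices

end NormalExp
end

noncomputable section


namespace NormalExp

/-! ### The metric read in a chart -/

section ChartMetric

variable (n : ℕ) {N : Type*} [TopologicalSpace N] [ChartedSpace (EuclideanSpace ℝ (Fin n)) N]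

/-- The derivative of the inverse of the chart centred at `p`. -/
def chartSymmDeriv (p : N) (y : EuclideanSpace ℝ (Fin n)) :
    EuclideanSpace ℝ (Fin n) →L[ℝ] EuclideanSpace ℝ (Fin n) :=
  mfderiv (𝓡 n) (𝓡 n) (extChartAt (𝓡 n) p).symm y

variable [IsManifold (𝓡 n) ∞ N]

lemma contMDiffOn_extChartAt_symm_target (p : N) :
    ContMDiffOn (𝓡 n) (𝓡 n) ∞ (extChartAt (𝓡 n) p).symm (extChartAt (𝓡 n) p).target :=
  contMDiffOn_extChartAt_symm p

lemma mdifferentiableAt_extChartAt_symm {p : N} {y : EuclideanSpace ℝ (Fin n)}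
    (hy : y ∈ (extChartAt (𝓡 n) p).target) :
    MDifferentiableAt (𝓡 n) (𝓡 n) (extChartAt (𝓡 n) p).symm y :=
  (((contMDiffOn_extChartAt_symm_target n p) y hy).contMDiffAt
    ((isOpen_extChartAt_target p).mem_nhds hy)).mdifferentiableAt (by simp)

lemma chartSymmDeriv_injective {p : N} {y : EuclideanSpace ℝ (Fin n)}
    (hy : y ∈ (extChartAt (𝓡 n) p).target) : Function.Injective (chartSymmDeriv n p y) := by
  have : IsManifold (𝓡 n) 1 N := .of_le (n := ∞) (by simp)
  have h := mfderiv_extChartAt_comp_mfderivWithin_extChartAt_symm (I := 𝓡 n) hy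
  simp only [modelWithCornersSelf_coe, Set.range_id, mfderivWithin_univ] at h
  intro u v huv
  have h1 := fun u ↦ congrArg (fun L : EuclideanSpace ℝ (Fin n) →L[ℝ] EuclideanSpace ℝ (Fin n) ↦ L u) h
  have hu := h1 u
  have hv := h1 v
  have : (mfderiv (𝓡 n) (𝓡 n) (extChartAt (𝓡 n) p).symm y) u =
    (mfderiv (𝓡 n) (𝓡 n) (extChartAt (𝓡 n) p).symm y) v := huv
  exact hu.symm.trans ((congrArg _ this).trans hv)

/-- The tangent space at `p` is identified with the model space through the preferred chart at `p`,
so this chart has identity derivative at its centre. This is why expressions computed in preferred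
charts are genuine tangent vectors and inner products. -/
lemma chartSymmDeriv_self (p : N) :
    chartSymmDeriv n p (extChartAt (𝓡 n) p p) = ContinuousLinearMap.id ℝ _ := by
  have : IsManifold (𝓡 n) 1 N := .of_le (n := ∞) (by simp)
  have h := mfderivWithin_range_extChartAt_symm (I := 𝓡 n) (x := p)
  simp only [modelWithCornersSelf_coe, Set.range_id, mfderivWithin_univ] at h
  exact h

/-- The derivative of a map, through its expression in a chart of the target. -/
lemma mfderiv_eq_chartSymmDeriv_comp {X : Type*} [NormedAddCommGroup X] [NormedSpace ℝ X]
    {φ : X → N} {x : X} (hφ : ContMDiffAt 𝓘(ℝ, X) (𝓡 n) ∞ φ x) {p : N}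
    (hp : φ x ∈ (chartAt (EuclideanSpace ℝ (Fin n)) p).source) :
    (mfderiv 𝓘(ℝ, X) (𝓡 n) φ x : X →L[ℝ] EuclideanSpace ℝ (Fin n)) =
      (chartSymmDeriv n p (extChartAt (𝓡 n) p (φ x))).comp
        (fderiv ℝ (fun z ↦ extChartAt (𝓡 n) p (φ z)) x) := by
  have : IsManifold (𝓡 n) 1 N := .of_le (n := ∞) (by simp)
  have hp' : φ x ∈ (extChartAt (𝓡 n) p).source := by simpa using hp
  have h1 : MDifferentiableAt 𝓘(ℝ, X) (𝓡 n) (fun z ↦ extChartAt (𝓡 n) p (φ z)) x :=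
    (mdifferentiableAt_extChartAt hp).comp x (hφ.mdifferentiableAt (by simp))
  have h2 := mdifferentiableAt_extChartAt_symm n ((extChartAt (𝓡 n) p).map_source hp')
  have h3 := mfderiv_comp x h2 h1
  rw [mfderiv_eq_fderiv] at h3
  refine Eq.trans ?_ h3
  refine Filter.EventuallyEq.mfderiv_eq ?_
  filter_upwards [hφ.continuousAt ((isOpen_extChartAt_source (I := 𝓡 n) p).mem_nhds hp')] with z hz
  exact ((extChartAt (𝓡 n) p).left_inv hz).symm

lemma contDiffAt_extChartAt_comp {X : Type*} [NormedAddCommGroup X] [NormedSpace ℝ X]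
    {φ : X → N} {x : X} (hφ : ContMDiffAt 𝓘(ℝ, X) (𝓡 n) ∞ φ x) {p : N}
    (hp : φ x ∈ (chartAt (EuclideanSpace ℝ (Fin n)) p).source) :
    ContDiffAt ℝ ∞ (fun z ↦ extChartAt (𝓡 n) p (φ z)) x :=
  ((contMDiffAt_extChartAt' hp).comp x hφ).contDiffAt

variable [RiemannianBundle (fun x : N ↦ TangentSpace (𝓡 n) x)]

/-- The inner product of two tangent vectors at `q`, the tangent space being identified with the
model space. -/
def innerAt (q : N) (u v : EuclideanSpace ℝ (Fin n)) : ℝ :=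
  @inner ℝ (TangentSpace (𝓡 n) q) _ u v

lemma innerAt_congr {q q' : N} {u u' v v' : EuclideanSpace ℝ (Fin n)} (hq : q = q') (hu : u = u')
    (hv : v = v') : innerAt n q u v = innerAt n q' u' v' := by rw [hq, hu, hv]

lemma innerAt_comm (q : N) (u v : EuclideanSpace ℝ (Fin n)) :
    innerAt n q u v = innerAt n q v u :=
  real_inner_comm (F := TangentSpace (𝓡 n) q) v u

lemma innerAt_sum_smul (q : N) {ι : Type*} (s : Finset ι) (c : ι → ℝ)
    (u : ι → EuclideanSpace ℝ (Fin n)) (v : EuclideanSpace ℝ (Fin n)) :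
    innerAt n q (∑ i ∈ s, c i • u i) v = ∑ i ∈ s, c i * innerAt n q (u i) v := by
  refine (sum_inner (𝕜 := ℝ) (E := TangentSpace (𝓡 n) q) s (fun i ↦ c i • u i) v).trans ?_
  exact Finset.sum_congr rfl fun i _ ↦ real_inner_smul_left (F := TangentSpace (𝓡 n) q) _ _ _

/-- The Riemannian metric, as a bilinear form, in the chart centred at `p`. -/
def metricForm (p : N) (y : EuclideanSpace ℝ (Fin n)) :
    EuclideanSpace ℝ (Fin n) →L[ℝ] EuclideanSpace ℝ (Fin n) →L[ℝ] ℝ :=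
  ∑ i, ∑ j, coordMetric n p y i j •
    (EuclideanSpace.proj i : EuclideanSpace ℝ (Fin n) →L[ℝ] ℝ).smulRight
      (EuclideanSpace.proj j : EuclideanSpace ℝ (Fin n) →L[ℝ] ℝ)

lemma metricForm_apply (p : N) (y v w : EuclideanSpace ℝ (Fin n)) :
    metricForm n p y v w = ∑ i, ∑ j, coordMetric n p y i j * (v i * w j) := by
  simp [metricForm]

lemma coordMetric_eq_innerAt (p : N) (y : EuclideanSpace ℝ (Fin n)) (i j : Fin n) :
    coordMetric n p y i j = innerAt n ((extChartAt (𝓡 n) p).symm y)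
      (chartSymmDeriv n p y (EuclideanSpace.single i 1))
      (chartSymmDeriv n p y (EuclideanSpace.single j 1)) := rfl

lemma metricForm_eq_innerAt (p : N) (y v w : EuclideanSpace ℝ (Fin n)) :
    metricForm n p y v w = innerAt n ((extChartAt (𝓡 n) p).symm y)
      (chartSymmDeriv n p y v) (chartSymmDeriv n p y w) := by
  have h : ∀ v : EuclideanSpace ℝ (Fin n), chartSymmDeriv n p y v =
      ∑ i, v i • chartSymmDeriv n p y (EuclideanSpace.single i 1) := fun v ↦ by
    conv_lhs => rw [← (EuclideanSpace.basisFun (Fin n) ℝ).sum_repr v]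
    simp
  rw [metricForm_apply, h v, innerAt_sum_smul]
  refine Finset.sum_congr rfl fun i _ ↦ ?_
  rw [innerAt_comm, h w, innerAt_sum_smul, Finset.mul_sum]
  refine Finset.sum_congr rfl fun j _ ↦ ?_
  rw [innerAt_comm, coordMetric_eq_innerAt]
  ring

lemma metricForm_comm (p : N) (y v w : EuclideanSpace ℝ (Fin n)) :
    metricForm n p y v w = metricForm n p y w v := by
  rw [metricForm_eq_innerAt, innerAt_comm, ← metricForm_eq_innerAt]

lemma metricForm_self (p : N) (v w : EuclideanSpace ℝ (Fin n)) :
    metricForm n p (extChartAt (𝓡 n) p p) v w = innerAt n p v w := by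
  rw [metricForm_eq_innerAt, chartSymmDeriv_self, extChartAt_to_inv]
  rfl

lemma innerAt_mfderiv {X : Type*} [NormedAddCommGroup X] [NormedSpace ℝ X]
    {φ : X → N} {x : X} (hφ : ContMDiffAt 𝓘(ℝ, X) (𝓡 n) ∞ φ x) {p : N}
    (hp : φ x ∈ (chartAt (EuclideanSpace ℝ (Fin n)) p).source) (u v : X) :
    innerAt n (φ x) (mfderiv 𝓘(ℝ, X) (𝓡 n) φ x u) (mfderiv 𝓘(ℝ, X) (𝓡 n) φ x v) =
      metricForm n p (extChartAt (𝓡 n) p (φ x))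
        (fderiv ℝ (fun z ↦ extChartAt (𝓡 n) p (φ z)) x u)
        (fderiv ℝ (fun z ↦ extChartAt (𝓡 n) p (φ z)) x v) := by
  rw [metricForm_eq_innerAt, (extChartAt (𝓡 n) p).left_inv (by simpa using hp)]
  have h := mfderiv_eq_chartSymmDeriv_comp n hφ hp
  exact congrArg₂ (innerAt n (φ x)) (congrArg (fun L : X →L[ℝ] EuclideanSpace ℝ (Fin n) ↦ L u) h)
    (congrArg (fun L : X →L[ℝ] EuclideanSpace ℝ (Fin n) ↦ L v) h)

lemma coordMetric_comm (p : N) (y : EuclideanSpace ℝ (Fin n)) (i j : Fin n) :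
    coordMetric n p y i j = coordMetric n p y j i := by
  rw [coordMetric_eq_innerAt, innerAt_comm]; rfl

lemma coordMetric_posDef {p : N} {y : EuclideanSpace ℝ (Fin n)}
    (hy : y ∈ (extChartAt (𝓡 n) p).target) : (coordMetric n p y).PosDef := by
  refine Matrix.PosDef.of_dotProduct_mulVec_pos (Matrix.IsHermitian.ext fun i j ↦ ?_) fun v hv ↦ ?_
  · simpa using coordMetric_comm n p y j i
  · have h1 : star v ⬝ᵥ (coordMetric n p y).mulVec v =
        metricForm n p y (WithLp.toLp 2 v) (WithLp.toLp 2 v) := by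
      rw [metricForm_apply]
      simp only [dotProduct, Matrix.mulVec, Finset.mul_sum, star_trivial, Pi.star_apply]
      refine Finset.sum_congr rfl fun i _ ↦ Finset.sum_congr rfl fun j _ ↦ ?_
      ring
    rw [h1, metricForm_eq_innerAt]
    refine real_inner_self_pos
      (F := TangentSpace (𝓡 n) ((extChartAt (𝓡 n) p).symm y)) |>.2 fun h0 ↦ hv ?_
    have := chartSymmDeriv_injective n hy (h0.trans (map_zero (chartSymmDeriv n p y)).symm)
    simpa using congrArg (WithLp.ofLp) this

variable [IsContMDiffRiemannianBundle (𝓡 n) ∞ (EuclideanSpace ℝ (Fin n))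
      (fun x : N ↦ TangentSpace (𝓡 n) x)]

/-- The coordinate fields are images of constant fields under the tangent map of the inverse chart,
hence smooth sections, and the metric is smooth on such sections. -/
lemma contDiffOn_coordMetric (p : N) (i j : Fin n) :
    ContDiffOn ℝ ∞ (fun y ↦ coordMetric n p y i j) (extChartAt (𝓡 n) p).target := by
  rw [← contMDiffOn_iff_contDiffOn]
  have hs : UniqueMDiffOn (𝓡 n) (extChartAt (𝓡 n) p).target :=
    (isOpen_extChartAt_target p).uniqueMDiffOn
  have h : ∀ i : Fin n, ContMDiffOn (𝓡 n) (𝓡 n).tangent ∞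
      (fun y ↦ (⟨(extChartAt (𝓡 n) p).symm y, coordFrame n p y i⟩ : TangentBundle (𝓡 n) N))
      (extChartAt (𝓡 n) p).target := fun i ↦ by
    have h1 := (contMDiffOn_extChartAt_symm_target n p).contMDiffOn_tangentMapWithin
      (m := ∞) (by simp) hs
    have h2 : ContMDiff (𝓡 n) (𝓡 n).tangent ∞ (fun y : EuclideanSpace ℝ (Fin n) ↦
        (⟨y, EuclideanSpace.single i (1 : ℝ)⟩ : TangentBundle (𝓡 n) (EuclideanSpace ℝ (Fin n)))) :=
      contMDiff_vectorSpace_iff_contDiff.2 contDiff_const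
    refine (h1.comp h2.contMDiffOn (fun y hy ↦ hy)).congr fun y hy ↦ ?_
    simp only [Function.comp, tangentMapWithin]
    rw [mfderivWithin_of_isOpen (isOpen_extChartAt_target p) hy]
    rfl
  exact ContMDiffOn.inner_bundle (h i) (h j)

end ChartMetric
end NormalExp
end

noncomputable section


namespace NormalExp

/-! ### The Levi-Civita connection and covariant derivatives along maps -/

section Christoffel

variable (n : ℕ) {N : Type*} [TopologicalSpace N] [ChartedSpace (EuclideanSpace ℝ (Fin n)) N]
  [IsManifold (𝓡 n) ∞ N] [RiemannianBundle (fun x : N ↦ TangentSpace (𝓡 n) x)]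

lemma coordMetricDeriv_comm (p : N) (y : EuclideanSpace ℝ (Fin n)) (k i j : Fin n) :
    coordMetricDeriv n p y k i j = coordMetricDeriv n p y k j i := by
  simp only [coordMetricDeriv, fun z ↦ coordMetric_comm n p z i j]

lemma christoffel_comm (p : N) (y : EuclideanSpace ℝ (Fin n)) (k i j : Fin n) :
    christoffel n p y k i j = christoffel n p y k j i := by
  simp only [christoffel]
  congr 1
  refine Finset.sum_congr rfl fun l _ ↦ ?_
  rw [coordMetricDeriv_comm n p y l]
  ring

lemma christoffelForm_comm (p : N) (y v w : EuclideanSpace ℝ (Fin n)) :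
    christoffelForm n p y v w = christoffelForm n p y w v := by
  simp only [christoffelForm]
  congr 1
  ext k
  rw [Finset.sum_comm]
  refine Finset.sum_congr rfl fun i _ ↦ Finset.sum_congr rfl fun j _ ↦ ?_
  rw [christoffel_comm]
  ring

lemma christoffelForm_smul_smul (p : N) (y v : EuclideanSpace ℝ (Fin n)) (r : ℝ) :
    christoffelForm n p y (r • v) (r • v) = r ^ 2 • christoffelForm n p y v v := by
  ext k
  simp only [christoffelForm, PiLp.smul_apply, smul_eq_mul, Finset.mul_sum]
  refine Finset.sum_congr rfl fun i _ ↦ Finset.sum_congr rfl fun j _ ↦ ?_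
  ring

lemma christoffelForm_zero (p : N) (y : EuclideanSpace ℝ (Fin n)) :
    christoffelForm n p y 0 0 = 0 := by
  simpa using christoffelForm_smul_smul n p y 0 0

variable [IsContMDiffRiemannianBundle (𝓡 n) ∞ (EuclideanSpace ℝ (Fin n))
      (fun x : N ↦ TangentSpace (𝓡 n) x)]

lemma differentiableAt_coordMetric {p : N} {y : EuclideanSpace ℝ (Fin n)}
    (hy : y ∈ (extChartAt (𝓡 n) p).target) (i j : Fin n) :
    DifferentiableAt ℝ (fun z ↦ coordMetric n p z i j) y :=
  ((contDiffOn_coordMetric n p i j).contDiffAt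
    ((isOpen_extChartAt_target p).mem_nhds hy)).differentiableAt (by simp)

lemma differentiableAt_sum_smul_const {E V ι : Type*} [Fintype ι] [NormedAddCommGroup E]
    [NormedSpace ℝ E] [NormedAddCommGroup V] [NormedSpace ℝ V] {g : E → ι → ι → ℝ} (B : ι → ι → V)
    {y : E} (hg : ∀ i j, DifferentiableAt ℝ (fun z ↦ g z i j) y) :
    DifferentiableAt ℝ (fun z ↦ ∑ i, ∑ j, g z i j • B i j) y :=
  DifferentiableAt.fun_sum fun i _ ↦ DifferentiableAt.fun_sum fun j _ ↦ (hg i j).smul_const _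

lemma differentiableAt_metricForm {p : N} {y : EuclideanSpace ℝ (Fin n)}
    (hy : y ∈ (extChartAt (𝓡 n) p).target) : DifferentiableAt ℝ (metricForm n p) y := by
  exact differentiableAt_sum_smul_const (V := EuclideanSpace ℝ (Fin n) →L[ℝ] EuclideanSpace ℝ (Fin n) →L[ℝ] ℝ) (fun i j ↦ (EuclideanSpace.proj i).smulRight
      (EuclideanSpace.proj j : EuclideanSpace ℝ (Fin n) →L[ℝ] ℝ))
    (differentiableAt_coordMetric n hy)

lemma fderiv_metricForm {p : N} {y : EuclideanSpace ℝ (Fin n)}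
    (hy : y ∈ (extChartAt (𝓡 n) p).target) (u v w : EuclideanSpace ℝ (Fin n)) :
    fderiv ℝ (metricForm n p) y u v w =
      ∑ i, ∑ j, ∑ k, coordMetricDeriv n p y k i j * (u k * v i * w j) := by
  have h1 := ((differentiableAt_metricForm n hy).hasFDerivAt.clm_apply
    (hasFDerivAt_const v y)).clm_apply (hasFDerivAt_const w y)
  have h2 : HasFDerivAt (fun z ↦ metricForm n p z v w)
      (∑ i, ∑ j, (v i * w j) • fderiv ℝ (fun z ↦ coordMetric n p z i j) y) y := by
    simp only [metricForm_apply]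
    exact HasFDerivAt.fun_sum fun i _ ↦ HasFDerivAt.fun_sum fun j _ ↦
      (differentiableAt_coordMetric n hy i j).hasFDerivAt.mul_const _
  have h3 := congrArg (fun L : EuclideanSpace ℝ (Fin n) →L[ℝ] ℝ ↦ L u) (h1.unique h2)
  have h : ∀ i j, fderiv ℝ (fun z ↦ coordMetric n p z i j) y u =
      ∑ k, u k * coordMetricDeriv n p y k i j := fun i j ↦ by
    conv_lhs => rw [← (EuclideanSpace.basisFun (Fin n) ℝ).sum_repr u]
    simp [coordMetricDeriv]
  simp only [sum_apply, smul_apply, smul_eq_mul, h, Finset.mul_sum] at h3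
  refine Eq.trans ?_ (h3.trans ?_)
  · simp
  · refine Finset.sum_congr rfl fun i _ ↦ Finset.sum_congr rfl fun j _ ↦
      Finset.sum_congr rfl fun k _ ↦ ?_
    ring

/-- Lowering the index cancels the inverse matrix in `christoffel`, the matrix of the metric being
positive definite on the chart target. -/
lemma sum_coordMetric_mul_christoffel {p : N} {y : EuclideanSpace ℝ (Fin n)}
    (hy : y ∈ (extChartAt (𝓡 n) p).target) (l i j : Fin n) :
    ∑ k, coordMetric n p y k l * christoffel n p y k i j = (1 / 2) *
      (coordMetricDeriv n p y i j l + coordMetricDeriv n p y j i l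
        - coordMetricDeriv n p y l i j) := by
  have hinv : coordMetric n p y * (coordMetric n p y)⁻¹ = 1 :=
    Matrix.mul_nonsing_inv _ (coordMetric_posDef n hy).det_pos.ne'.isUnit
  set D : Fin n → ℝ := fun l ↦ coordMetricDeriv n p y i j l + coordMetricDeriv n p y j i l
        - coordMetricDeriv n p y l i j with hD
  have h1 : ∀ k, christoffel n p y k i j = (1 / 2) * ((coordMetric n p y)⁻¹.mulVec D) k :=
    fun k ↦ rfl
  calc _ = (1 / 2) * ((coordMetric n p y).mulVec ((coordMetric n p y)⁻¹.mulVec D)) l := by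
        simp only [h1]
        rw [Matrix.mulVec, dotProduct, Finset.mul_sum]
        refine Finset.sum_congr rfl fun k _ ↦ ?_
        rw [coordMetric_comm n p y k l]
        ring
    _ = _ := by rw [Matrix.mulVec_mulVec, hinv, Matrix.one_mulVec]

/-- The Koszul formula. -/
lemma metricForm_christoffelForm {p : N} {y : EuclideanSpace ℝ (Fin n)}
    (hy : y ∈ (extChartAt (𝓡 n) p).target) (u v w : EuclideanSpace ℝ (Fin n)) :
    metricForm n p y (christoffelForm n p y u v) w =
      (1 / 2) * (fderiv ℝ (metricForm n p) y u v w + fderiv ℝ (metricForm n p) y v u w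
        - fderiv ℝ (metricForm n p) y w u v) := by
  have h1 : metricForm n p y (christoffelForm n p y u v) w =
      ∑ i, ∑ j, ∑ l, (∑ k, coordMetric n p y k l * christoffel n p y k i j) *
        (u i * v j * w l) := by
    rw [metricForm_apply]
    simp only [christoffelForm, Finset.sum_mul, Finset.mul_sum]
    rw [Finset.sum_congr rfl fun k _ ↦ Finset.sum_comm_cycle.symm, ← Finset.sum_comm_cycle]
    refine Finset.sum_congr rfl fun i _ ↦ Finset.sum_congr rfl fun j _ ↦ ?_
    rw [Finset.sum_comm]
    refine Finset.sum_congr rfl fun l _ ↦ Finset.sum_congr rfl fun k _ ↦ ?_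
    ring
  rw [h1, fderiv_metricForm n hy, fderiv_metricForm n hy, fderiv_metricForm n hy]
  simp only [sum_coordMetric_mul_christoffel n hy]
  have e1 : ∑ i, ∑ j, ∑ k, coordMetricDeriv n p y k i j * (u k * v i * w j) =
      ∑ i, ∑ j, ∑ l, coordMetricDeriv n p y i j l * (u i * v j * w l) := by
    rw [Finset.sum_comm_cycle]
  have e2 : ∑ i, ∑ j, ∑ k, coordMetricDeriv n p y k i j * (v k * u i * w j) =
      ∑ i, ∑ j, ∑ l, coordMetricDeriv n p y j i l * (u i * v j * w l) := by
    refine Finset.sum_congr rfl fun i _ ↦ ?_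
    rw [Finset.sum_comm]
    refine Finset.sum_congr rfl fun j _ ↦ Finset.sum_congr rfl fun k _ ↦ ?_
    ring
  have e3 : ∑ i, ∑ j, ∑ k, coordMetricDeriv n p y k i j * (w k * u i * v j) =
      ∑ i, ∑ j, ∑ l, coordMetricDeriv n p y l i j * (u i * v j * w l) := by
    refine Finset.sum_congr rfl fun i _ ↦ ?_
    refine Finset.sum_congr rfl fun j _ ↦ Finset.sum_congr rfl fun k _ ↦ ?_
    ring
  rw [e1, e2, e3]
  simp only [← Finset.sum_add_distrib, ← Finset.sum_sub_distrib, Finset.mul_sum]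
  refine Finset.sum_congr rfl fun i _ ↦ Finset.sum_congr rfl fun j _ ↦
    Finset.sum_congr rfl fun k _ ↦ ?_
  ring

lemma fderiv_metricForm_comm {p : N} {y : EuclideanSpace ℝ (Fin n)}
    (hy : y ∈ (extChartAt (𝓡 n) p).target) (u v w : EuclideanSpace ℝ (Fin n)) :
    fderiv ℝ (metricForm n p) y u v w = fderiv ℝ (metricForm n p) y u w v := by
  rw [fderiv_metricForm n hy, fderiv_metricForm n hy]
  rw [Finset.sum_comm]
  refine Finset.sum_congr rfl fun i _ ↦ Finset.sum_congr rfl fun j _ ↦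
    Finset.sum_congr rfl fun k _ ↦ ?_
  rw [coordMetricDeriv_comm]
  ring

/-- The Levi-Civita connection is metric. -/
lemma fderiv_metricForm_eq {p : N} {y : EuclideanSpace ℝ (Fin n)}
    (hy : y ∈ (extChartAt (𝓡 n) p).target) (u v w : EuclideanSpace ℝ (Fin n)) :
    fderiv ℝ (metricForm n p) y u v w =
      metricForm n p y (christoffelForm n p y u v) w
        + metricForm n p y v (christoffelForm n p y u w) := by
  -- In the sum of the two Koszul formulas the derivatives in the directions `v` and `w` cancel, by
  -- symmetry of the metric, and the derivative in direction `u` occurs twice with factor `1/2`.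
  rw [metricForm_comm n p y v, metricForm_christoffelForm n hy, metricForm_christoffelForm n hy,
    fderiv_metricForm_comm n hy u w v, fderiv_metricForm_comm n hy v u w,
    fderiv_metricForm_comm n hy w u v]
  ring

/-- Cramer's rule gives smoothness of the inverse matrix. Class `C¹` is all that is needed: it makes
the geodesic vector field locally Lipschitz. -/
lemma contDiffAt_christoffel {p : N} {y : EuclideanSpace ℝ (Fin n)}
    (hy : y ∈ (extChartAt (𝓡 n) p).target) (k i j : Fin n) :
    ContDiffAt ℝ 1 (fun z ↦ christoffel n p z k i j) y := by
  have hg : ∀ i j, ContDiffAt ℝ ∞ (fun z ↦ coordMetric n p z i j) y := fun i j ↦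
    (contDiffOn_coordMetric n p i j).contDiffAt ((isOpen_extChartAt_target p).mem_nhds hy)
  have hdet : ∀ A : EuclideanSpace ℝ (Fin n) → Matrix (Fin n) (Fin n) ℝ,
      (∀ i j, ContDiffAt ℝ ∞ (fun z ↦ A z i j) y) → ContDiffAt ℝ ∞ (fun z ↦ (A z).det) y := by
    intro A hA
    simp only [Matrix.det_apply]
    exact ContDiffAt.sum fun σ _ ↦ (contDiffAt_prod fun i _ ↦ hA _ _).const_smul _
  have hinv : ∀ k l, ContDiffAt ℝ ∞ (fun z ↦ (coordMetric n p z)⁻¹ k l) y := by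
    intro k l
    simp only [Matrix.inv_def, Matrix.smul_apply, smul_eq_mul, Ring.inverse_eq_inv',
      Matrix.adjugate_apply]
    refine ((hdet _ hg).inv (coordMetric_posDef n hy).det_pos.ne').mul (hdet _ fun i j ↦ ?_)
    by_cases h : i = l
    · simpa [h, Matrix.updateRow_apply] using contDiffAt_const (c := (Pi.single k (1 : ℝ) : Fin n → ℝ) j)
    · simpa [h, Matrix.updateRow_apply] using hg i j
  have hd : ∀ k i j, ContDiffAt ℝ 1 (fun z ↦ coordMetricDeriv n p z k i j) y := fun k i j ↦
    ((hg i j).fderiv_right (m := 1) (by norm_cast)).clm_apply contDiffAt_const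
  simp only [christoffel]
  exact contDiffAt_const.mul (ContDiffAt.sum fun l _ ↦ ((hinv k l).of_le (by simp)).mul
    (((hd _ _ _).add (hd _ _ _)).sub (hd _ _ _)))

lemma contDiffAt_christoffelForm {p : N} {y : EuclideanSpace ℝ (Fin n)}
    (hy : y ∈ (extChartAt (𝓡 n) p).target) (v : EuclideanSpace ℝ (Fin n)) :
    ContDiffAt ℝ 1 (fun z : EuclideanSpace ℝ (Fin n) × EuclideanSpace ℝ (Fin n) ↦
      christoffelForm n p z.1 z.2 z.2) (y, v) := by
  rw [contDiffAt_euclidean]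
  intro k
  simp only [christoffelForm]
  have hc : ∀ i, ContDiffAt ℝ 1 (fun z : EuclideanSpace ℝ (Fin n) × EuclideanSpace ℝ (Fin n) ↦
      z.2 i) (y, v) := fun i ↦
    ((EuclideanSpace.proj i : EuclideanSpace ℝ (Fin n) →L[ℝ] ℝ).contDiff.comp contDiff_snd).contDiffAt
  refine ContDiffAt.sum fun i _ ↦ ContDiffAt.sum fun j _ ↦ (ContDiffAt.mul ?_ (hc i)).mul (hc j)
  exact ContDiffAt.comp (g := fun z ↦ christoffel n p z k i j) (y, v)
    (contDiffAt_christoffel n hy k i j) contDiffAt_fst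

/-- The coefficient `g (∂_u φ, ∂_v φ)` of the metric pulled back by a map `φ` of a vector space
into `N`. -/
def inducedForm {X : Type*} [NormedAddCommGroup X] [NormedSpace ℝ X] (φ : X → N) (u v x : X) : ℝ :=
  innerAt n (φ x) (mfderiv 𝓘(ℝ, X) (𝓡 n) φ x u) (mfderiv 𝓘(ℝ, X) (𝓡 n) φ x v)

lemma inducedForm_comm {X : Type*} [NormedAddCommGroup X] [NormedSpace ℝ X] (φ : X → N)
    (u v x : X) : inducedForm n φ u v x = inducedForm n φ v u x :=
  innerAt_comm n _ _ _

section Induced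

variable {X : Type*} [NormedAddCommGroup X] [NormedSpace ℝ X]

/-- Equality on a neighbourhood is required because both sides get differentiated. The chart centre
`p` is left free so that two maps meeting at a point can be compared in one chart. -/
lemma inducedForm_eventuallyEq
    {φ : X → N} {x : X} (hφ : ∀ᶠ z in 𝓝 x, ContMDiffAt 𝓘(ℝ, X) (𝓡 n) ∞ φ z) {p : N}
    (hp : φ x ∈ (chartAt (EuclideanSpace ℝ (Fin n)) p).source) {F : X → EuclideanSpace ℝ (Fin n)}
    (hF : F = fun z ↦ extChartAt (𝓡 n) p (φ z)) (u v : X) : inducedForm n φ u v =ᶠ[𝓝 x]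
    fun z ↦ metricForm n p (F z) (fderiv ℝ F z u) (fderiv ℝ F z v) := by
  filter_upwards [hφ, hφ.self_of_nhds.continuousAt
    ((chartAt (EuclideanSpace ℝ (Fin n)) p).open_source.mem_nhds hp)] with z hz hz'
  rw [inducedForm, innerAt_mfderiv n hz hz', hF]

lemma differentiableAt_inducedForm
    {φ : X → N} {x : X} (hφ : ∀ᶠ z in 𝓝 x, ContMDiffAt 𝓘(ℝ, X) (𝓡 n) ∞ φ z) {p : N}
    (hp : φ x ∈ (chartAt (EuclideanSpace ℝ (Fin n)) p).source) {F : X → EuclideanSpace ℝ (Fin n)}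
    (hF : F = fun z ↦ extChartAt (𝓡 n) p (φ z)) (u v : X) : DifferentiableAt ℝ (inducedForm n φ u v) x := by
  have hy : F x ∈ (extChartAt (𝓡 n) p).target := by
    rw [hF]; exact (extChartAt (𝓡 n) p).map_source (by simpa using hp)
  have hFd : ContDiffAt ℝ ∞ F x := hF ▸ contDiffAt_extChartAt_comp n hφ.self_of_nhds hp
  exact (differentiableAt_pullback_form (hFd.of_le (by norm_cast))
    (differentiableAt_metricForm n hy) u v).congr_of_eventuallyEq
    (inducedForm_eventuallyEq n hφ hp hF u v)

/-- The derivative of the inner products of the partial derivatives of a map into `N`, in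
terms of covariant derivatives. -/
lemma fderiv_inducedForm
    {φ : X → N} {x : X} (hφ : ∀ᶠ z in 𝓝 x, ContMDiffAt 𝓘(ℝ, X) (𝓡 n) ∞ φ z) {p : N}
    (hp : φ x ∈ (chartAt (EuclideanSpace ℝ (Fin n)) p).source) {F : X → EuclideanSpace ℝ (Fin n)}
    (hF : F = fun z ↦ extChartAt (𝓡 n) p (φ z)) (u v w : X) :
    fderiv ℝ (inducedForm n φ u v) x w =
      metricForm n p (F x) (fderiv ℝ (fderiv ℝ F) x w u
        + christoffelForm n p (F x) (fderiv ℝ F x w) (fderiv ℝ F x u)) (fderiv ℝ F x v)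
      + metricForm n p (F x) (fderiv ℝ F x u) (fderiv ℝ (fderiv ℝ F) x w v
        + christoffelForm n p (F x) (fderiv ℝ F x w) (fderiv ℝ F x v)) := by
  have hy : F x ∈ (extChartAt (𝓡 n) p).target := by
    rw [hF]; exact (extChartAt (𝓡 n) p).map_source (by simpa using hp)
  have hFd : ContDiffAt ℝ ∞ F x := hF ▸ contDiffAt_extChartAt_comp n hφ.self_of_nhds hp
  rw [(inducedForm_eventuallyEq n hφ hp hF u v).fderiv_eq]
  exact fderiv_pullback_form (G := metricForm n p) (Γ := christoffelForm n p (F x))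
    (hFd.of_le (by norm_cast)) (differentiableAt_metricForm n hy)
    (fderiv_metricForm_eq n hy) u v w

/-- The torsion-freeness of the Levi-Civita connection. -/
lemma covariantDeriv_comm
    {φ : X → N} {x : X} (hφ : ∀ᶠ z in 𝓝 x, ContMDiffAt 𝓘(ℝ, X) (𝓡 n) ∞ φ z) {p : N}
    (hp : φ x ∈ (chartAt (EuclideanSpace ℝ (Fin n)) p).source) {F : X → EuclideanSpace ℝ (Fin n)}
    (hF : F = fun z ↦ extChartAt (𝓡 n) p (φ z)) (u v : X) :
    fderiv ℝ (fderiv ℝ F) x u v + christoffelForm n p (F x) (fderiv ℝ F x u) (fderiv ℝ F x v) =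
    fderiv ℝ (fderiv ℝ F) x v u + christoffelForm n p (F x) (fderiv ℝ F x v) (fderiv ℝ F x u) := by
  have hFd : ContDiffAt ℝ ∞ F x := hF ▸ contDiffAt_extChartAt_comp n hφ.self_of_nhds hp
  rw [christoffelForm_comm, (hFd.isSymmSndFDerivAt (by simp; norm_cast)).eq u v]

end Induced

end Christoffel
end NormalExp
end

noncomputable section


namespace NormalExp

/-! ### Uniqueness and scaling of geodesics; the exponential map -/

section Geodesics

variable (n : ℕ) {N : Type*} [TopologicalSpace N] [ChartedSpace (EuclideanSpace ℝ (Fin n)) N]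
  [IsManifold (𝓡 n) ∞ N] [RiemannianBundle (fun x : N ↦ TangentSpace (𝓡 n) x)]
  [IsContMDiffRiemannianBundle (𝓡 n) ∞ (EuclideanSpace ℝ (Fin n))
      (fun x : N ↦ TangentSpace (𝓡 n) x)]

/-- The geodesic equation as an autonomous first-order system for position and velocity, the form to
which uniqueness for ODEs applies. -/
lemma IsGeodesic.hasDerivAt {γ : ℝ → N} (hγ : IsGeodesic n γ) {p : N} {t : ℝ}
    (hp : γ t ∈ (chartAt (EuclideanSpace ℝ (Fin n)) p).source) :
    HasDerivAt (fun t ↦ (extChartAt (𝓡 n) p (γ t), deriv (fun s ↦ extChartAt (𝓡 n) p (γ s)) t))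
      (deriv (fun s ↦ extChartAt (𝓡 n) p (γ s)) t,
        -christoffelForm n p (extChartAt (𝓡 n) p (γ t))
          (deriv (fun s ↦ extChartAt (𝓡 n) p (γ s)) t)
          (deriv (fun s ↦ extChartAt (𝓡 n) p (γ s)) t)) t := by
  have h := contDiffAt_extChartAt_comp n (hγ.1 t) hp
  rw [← eq_neg_of_add_eq_zero_left (hγ.2 p t hp)]
  refine (h.differentiableAt (by simp)).hasDerivAt.prodMk ?_
  have h2 : ContDiffAt ℝ 1 (deriv fun s ↦ extChartAt (𝓡 n) p (γ s)) t := by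
    have := (h.fderiv_right (m := 1) (by norm_cast)).clm_apply
      (contDiffAt_const (c := (1 : ℝ)))
    exact this
  exact (h2.differentiableAt (by simp)).hasDerivAt

lemma IsGeodesic.continuousAt_deriv {γ : ℝ → N} (hγ : IsGeodesic n γ) {p : N} {t : ℝ}
    (hp : γ t ∈ (chartAt (EuclideanSpace ℝ (Fin n)) p).source) :
    ContinuousAt (deriv fun s ↦ extChartAt (𝓡 n) p (γ s)) t :=
  (hγ.hasDerivAt n hp).continuousAt.snd

lemma IsGeodesic.eventually_mem_source {γ : ℝ → N} (hγ : IsGeodesic n γ) {p : N} {t : ℝ}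
    (hp : γ t ∈ (chartAt (EuclideanSpace ℝ (Fin n)) p).source) :
    ∀ᶠ s in 𝓝 t, γ s ∈ (chartAt (EuclideanSpace ℝ (Fin n)) p).source :=
  hγ.1.continuous.continuousAt ((chartAt (EuclideanSpace ℝ (Fin n)) p).open_source.mem_nhds hp)

/-- Local uniqueness of geodesics. -/
lemma IsGeodesic.eventuallyEq {γ₁ γ₂ : ℝ → N} (h₁ : IsGeodesic n γ₁) (h₂ : IsGeodesic n γ₂)
    {p : N} {t : ℝ} (hp : γ₁ t ∈ (chartAt (EuclideanSpace ℝ (Fin n)) p).source)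
    (h0 : γ₁ t = γ₂ t) (hd : deriv (fun s ↦ extChartAt (𝓡 n) p (γ₁ s)) t =
      deriv (fun s ↦ extChartAt (𝓡 n) p (γ₂ s)) t) : γ₁ =ᶠ[𝓝 t] γ₂ := by
  have hp₂ : γ₂ t ∈ (chartAt (EuclideanSpace ℝ (Fin n)) p).source := h0 ▸ hp
  set V : EuclideanSpace ℝ (Fin n) × EuclideanSpace ℝ (Fin n) →
      EuclideanSpace ℝ (Fin n) × EuclideanSpace ℝ (Fin n) :=
    fun z ↦ (z.2, -christoffelForm n p z.1 z.2 z.2) with hV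
  set c : (ℝ → N) → ℝ → EuclideanSpace ℝ (Fin n) × EuclideanSpace ℝ (Fin n) :=
    fun γ t ↦ (extChartAt (𝓡 n) p (γ t), deriv (fun s ↦ extChartAt (𝓡 n) p (γ s)) t) with hc
  have hy : extChartAt (𝓡 n) p (γ₁ t) ∈ (extChartAt (𝓡 n) p).target :=
    (extChartAt (𝓡 n) p).map_source (by simpa using hp)
  have hVd : ContDiffAt ℝ 1 V (c γ₁ t) :=
    contDiffAt_snd.prodMk (contDiffAt_christoffelForm n hy _).neg
  obtain ⟨K, s, hs, hK⟩ := hVd.exists_lipschitzOnWith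
  have heq : c γ₁ t = c γ₂ t := by simp only [hc, h0, hd]
  have h : ∀ γ : ℝ → N, IsGeodesic n γ →
      γ t ∈ (chartAt (EuclideanSpace ℝ (Fin n)) p).source → c γ t = c γ₁ t →
      ∀ᶠ r in 𝓝 t, HasDerivAt (c γ) (V (c γ r)) r ∧ c γ r ∈ s := fun γ hγ hpγ hcγ ↦ by
    have hcont : ContinuousAt (c γ) t := (hγ.hasDerivAt n hpγ).continuousAt
    filter_upwards [hγ.eventually_mem_source n hpγ, hcont (hcγ ▸ hs)] with r hr hr'
    exact ⟨hγ.hasDerivAt n hr, hr'⟩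
  have hcc := ODE_solution_unique_of_eventually (v := fun _ ↦ V) (s := fun _ ↦ s)
    (Filter.Eventually.of_forall fun _ ↦ hK) (h γ₁ h₁ hp rfl) (h γ₂ h₂ hp₂ heq.symm) heq
  filter_upwards [hcc, h₁.eventually_mem_source n hp, h₂.eventually_mem_source n hp₂]
    with r hr hr₁ hr₂
  exact (extChartAt (𝓡 n) p).injOn (by simpa using hr₁) (by simpa using hr₂)
    (congrArg Prod.fst hr)

lemma mfderiv_eq_deriv {γ : ℝ → N} {t : ℝ} (hγ : ContMDiffAt 𝓘(ℝ, ℝ) (𝓡 n) ∞ γ t) :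
    (mfderiv 𝓘(ℝ, ℝ) (𝓡 n) γ t (1 : ℝ) : EuclideanSpace ℝ (Fin n)) =
      deriv (fun s ↦ extChartAt (𝓡 n) (γ t) (γ s)) t := by
  have h := mfderiv_eq_chartSymmDeriv_comp n hγ (mem_chart_source _ (γ t))
  rw [chartSymmDeriv_self] at h
  exact congrArg (fun L : ℝ →L[ℝ] EuclideanSpace ℝ (Fin n) ↦ L 1) h

/-- Splits an equality in the tangent bundle into base points and vectors of the fixed model space,
avoiding transport between tangent spaces. -/
lemma velocity_eq_iff {γ : ℝ → N} {t : ℝ} {V : TangentBundle (𝓡 n) N} :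
    velocity n γ t = V ↔ γ t = V.proj ∧
      (mfderiv 𝓘(ℝ, ℝ) (𝓡 n) γ t (1 : ℝ) : EuclideanSpace ℝ (Fin n)) = V.2 := by
  obtain ⟨q, v⟩ := V
  constructor
  · rintro h
    have h1 : γ t = q := congrArg TotalSpace.proj h
    subst h1
    exact ⟨rfl, eq_of_heq (TotalSpace.mk.inj h).2⟩
  · rintro ⟨h1, h2⟩
    change γ t = q at h1
    subst h1
    exact congrArg (TotalSpace.mk (γ t)) h2

variable [T2Space N]

/-- A geodesic is determined by its initial velocity. -/
lemma IsGeodesic.eq_of_velocity_eq {γ₁ γ₂ : ℝ → N} (h₁ : IsGeodesic n γ₁) (h₂ : IsGeodesic n γ₂)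
    (h0 : velocity n γ₁ 0 = velocity n γ₂ 0) : γ₁ = γ₂ := by
  -- Connectedness of `ℝ`: the set of times at which the two germs agree is open, closed and
  -- contains `0`.
  set S : Set ℝ := {t | γ₁ =ᶠ[𝓝 t] γ₂} with hS
  have hopen : IsOpen S := isOpen_iff_eventually.2 fun t ht ↦ ht.eventually_nhds
  have hclosed : IsClosed S := by
    refine isClosed_of_closure_subset fun t ht ↦ ?_
    have hfreq : ∃ᶠ s in 𝓝 t, s ∈ S := mem_closure_iff_frequently.1 ht
    have hpt : γ₁ t = γ₂ t := by
      have hcl : IsClosed {s | γ₁ s = γ₂ s} := isClosed_eq h₁.1.continuous h₂.1.continuous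
      exact hcl.closure_subset (closure_mono (fun s hs ↦ Filter.EventuallyEq.eq_of_nhds hs) ht)
    have hp := mem_chart_source (EuclideanSpace ℝ (Fin n)) (γ₁ t)
    refine h₁.eventuallyEq n h₂ hp hpt ?_
    have c₁ := h₁.continuousAt_deriv n hp
    have hp₂ : γ₂ t ∈ (chartAt (EuclideanSpace ℝ (Fin n)) (γ₁ t)).source := by rwa [← hpt]
    have c₂ := h₂.continuousAt_deriv n hp₂
    -- Different velocities at the limit time would stay different nearby by continuity, but
    -- arbitrarily close there are times where the germs agree.
    by_contra hne
    have := (c₁.prodMk c₂).eventually (isOpen_ne_fun continuous_fst continuous_snd |>.mem_nhds hne)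
    obtain ⟨s, hs, hs'⟩ := (hfreq.and_eventually this).exists
    refine hs' (Filter.EventuallyEq.deriv_eq ?_)
    filter_upwards [hs] with r hr
    rw [hr]
  have h0S : (0 : ℝ) ∈ S := by
    obtain ⟨e1, e2⟩ := (velocity_eq_iff n).1 h0
    have e1' : γ₁ 0 = γ₂ 0 := e1
    have e3 := e2
    change (mfderiv 𝓘(ℝ, ℝ) (𝓡 n) γ₁ 0 (1 : ℝ) : EuclideanSpace ℝ (Fin n)) =
      mfderiv 𝓘(ℝ, ℝ) (𝓡 n) γ₂ 0 (1 : ℝ) at e3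
    rw [mfderiv_eq_deriv n (h₁.1 0), mfderiv_eq_deriv n (h₂.1 0), ← e1'] at e3
    exact h₁.eventuallyEq n h₂ (mem_chart_source _ (γ₁ 0)) e1' e3
  have huniv : S = Set.univ := IsClopen.eq_univ ⟨hclosed, hopen⟩ ⟨0, h0S⟩
  funext t
  have : t ∈ S := huniv ▸ Set.mem_univ t
  exact Filter.EventuallyEq.eq_of_nhds this

/-- `expMap` evaluates a chosen geodesic; uniqueness makes the choice immaterial. -/
lemma IsGeodesic.expMap_velocity {γ : ℝ → N} (hγ : IsGeodesic n γ) :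
    expMap n (velocity n γ 0) = γ 1 := by
  have h : ∃ γ' : ℝ → N, IsGeodesic n γ' ∧ velocity n γ' 0 = velocity n γ 0 := ⟨γ, hγ, rfl⟩
  rw [expMap, dif_pos h, h.choose_spec.1.eq_of_velocity_eq n hγ h.choose_spec.2]

lemma deriv_comp_mul (u : ℝ → EuclideanSpace ℝ (Fin n)) (r : ℝ) :
    deriv (fun s ↦ u (r * s)) = fun s ↦ r • deriv u (r * s) := by
  funext s
  exact deriv_comp_mul_left r u s

/-- Both terms of the geodesic equation are homogeneous of degree two in the speed. No condition on
`r` is needed, so constant and reversed geodesics are covered. -/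
lemma IsGeodesic.comp_mul {γ : ℝ → N} (hγ : IsGeodesic n γ) (r : ℝ) :
    IsGeodesic n (fun s ↦ γ (r * s)) := by
  refine ⟨hγ.1.comp (contDiff_const.mul contDiff_id).contMDiff, fun p t hp ↦ ?_⟩
  have h := hγ.2 p (r * t) hp
  set u : ℝ → EuclideanSpace ℝ (Fin n) := fun s ↦ extChartAt (𝓡 n) p (γ s) with hu
  change deriv (deriv fun s ↦ u (r * s)) t + christoffelForm n p (u (r * t))
    (deriv (fun s ↦ u (r * s)) t) (deriv (fun s ↦ u (r * s)) t) = 0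
  have h2 : deriv (fun s ↦ r • deriv u (r * s)) t = r ^ 2 • deriv (deriv u) (r * t) := by
    rw [deriv_fun_const_smul_field, deriv_comp_mul, smul_smul, sq]
  rw [deriv_comp_mul, h2]
  simp only [christoffelForm_smul_smul]
  rw [← smul_add, h, smul_zero]

lemma IsGeodesic.expMap_smul {γ : ℝ → N} (hγ : IsGeodesic n γ) {V : TangentBundle (𝓡 n) N}
    (hV : velocity n γ 0 = V) (r : ℝ) : expMap n ⟨V.proj, r • V.2⟩ = γ r := by
  have h := (hγ.comp_mul n r).expMap_velocity n
  rw [mul_one] at h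
  rw [← h]
  congr 1
  symm
  rw [velocity_eq_iff]
  rw [velocity_eq_iff] at hV
  refine ⟨by simpa using hV.1, ?_⟩
  rw [mfderiv_eq_deriv n ((hγ.comp_mul n r).1 0)]
  have h1 := deriv_comp_mul n (fun s ↦ extChartAt (𝓡 n) (γ (r * 0)) (γ s)) r
  rw [h1]
  simp only [mul_zero]
  rw [← mfderiv_eq_deriv n (hγ.1 0), hV.2]
  rfl

lemma isGeodesic_expMap_smul {V : TangentBundle (𝓡 n) N} (hV : V ∈ expDomain n) :
    IsGeodesic n (fun r : ℝ ↦ expMap n ⟨V.proj, r • V.2⟩) ∧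
      velocity n (fun r : ℝ ↦ expMap n ⟨V.proj, r • V.2⟩) 0 = V := by
  obtain ⟨γ, hγ, h0⟩ := hV
  have : (fun r : ℝ ↦ expMap n ⟨V.proj, r • V.2⟩) = γ := funext fun r ↦ hγ.expMap_smul n h0 r
  rw [this]
  exact ⟨hγ, h0⟩

lemma isGeodesic_const (q : N) : IsGeodesic n (fun _ ↦ q) :=
  ⟨contMDiff_const, fun p t _ ↦ by simp [christoffelForm_zero]⟩

lemma expMap_zero (q : N) : expMap n (⟨q, 0⟩ : TangentBundle (𝓡 n) N) = q := by
  refine Eq.trans (congrArg (expMap n) (Eq.symm ?_)) ((isGeodesic_const n q).expMap_velocity n)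
  rw [velocity_eq_iff]
  exact ⟨rfl, by rw [mfderiv_const]; rfl⟩

end Geodesics
end NormalExp
end

noncomputable section


namespace NormalExp

/-! ### Gauss lemma, first variation, and comparison of a graph with a slice -/

section Comparison

variable (n : ℕ) {N : Type*} [TopologicalSpace N] [ChartedSpace (EuclideanSpace ℝ (Fin n)) N]
  [IsManifold (𝓡 n) ∞ N] [RiemannianBundle (fun x : N ↦ TangentSpace (𝓡 n) x)]
  [IsContMDiffRiemannianBundle (𝓡 n) ∞ (EuclideanSpace ℝ (Fin n))
      (fun x : N ↦ TangentSpace (𝓡 n) x)]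
  {X : Type*} [NormedAddCommGroup X] [NormedSpace ℝ X]

/-- A family of geodesics `r ↦ Φ (r, z)`, smooth in all variables, has vanishing radial covariant
acceleration. -/
lemma radial_acceleration_eq_zero {Φ : ℝ × X → N} {r : ℝ} {a : X}
    (hΦ : ContMDiffAt 𝓘(ℝ, ℝ × X) (𝓡 n) ∞ Φ (r, a))
    (hgeo : IsGeodesic n fun s ↦ Φ (s, a)) {p : N}
    (hp : Φ (r, a) ∈ (chartAt (EuclideanSpace ℝ (Fin n)) p).source)
    {F : ℝ × X → EuclideanSpace ℝ (Fin n)} (hF : F = fun z ↦ extChartAt (𝓡 n) p (Φ z)) :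
    fderiv ℝ (fderiv ℝ F) (r, a) (1, 0) (1, 0) + christoffelForm n p (F (r, a))
      (fderiv ℝ F (r, a) (1, 0)) (fderiv ℝ F (r, a) (1, 0)) = 0 := by
  have hFd : ContDiffAt ℝ ∞ F (r, a) := hF ▸ contDiffAt_extChartAt_comp n hΦ hp
  obtain ⟨h1, h2⟩ := deriv_fst_slice (hFd.of_le (by norm_cast))
  have h := hgeo.2 p r hp
  rw [← h1, ← h2, hF]
  exact h

variable {Φ : ℝ × X → N} {B : Set X}

lemma eventually_contMDiffAt (hB : IsOpen B)
    (hΦ : ∀ r, ∀ z ∈ B, ContMDiffAt 𝓘(ℝ, ℝ × X) (𝓡 n) ∞ Φ (r, z)) (r : ℝ) {a : X} (ha : a ∈ B) :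
    ∀ᶠ z in 𝓝 (r, a), ContMDiffAt 𝓘(ℝ, ℝ × X) (𝓡 n) ∞ Φ z := by
  filter_upwards [continuous_snd.continuousAt (hB.mem_nhds ha)] with z hz using hΦ z.1 z.2 hz

lemma hasDerivAt_inducedForm_slice (hB : IsOpen B)
    (hΦ : ∀ r, ∀ z ∈ B, ContMDiffAt 𝓘(ℝ, ℝ × X) (𝓡 n) ∞ Φ (r, z)) (r : ℝ) {a : X} (ha : a ∈ B)
    (u v : ℝ × X) : HasDerivAt (fun s ↦ inducedForm n Φ u v (s, a))
      (fderiv ℝ (inducedForm n Φ u v) (r, a) (1, 0)) r :=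
  HasFDerivAt.comp_hasDerivAt (l := inducedForm n Φ u v) (f := fun s : ℝ ↦ (s, a)) r
    (differentiableAt_inducedForm n (eventually_contMDiffAt n hB hΦ r ha)
      (mem_chart_source _ _) rfl u v).hasFDerivAt
    ((hasDerivAt_id r).prodMk (hasDerivAt_const r a))

/-- The Gauss lemma, for a family of geodesics whose initial velocities are unit vectors normal to
the initial submanifold. -/
lemma gauss (hB : IsOpen B)
    (hΦ : ∀ r, ∀ z ∈ B, ContMDiffAt 𝓘(ℝ, ℝ × X) (𝓡 n) ∞ Φ (r, z))
    (hgeo : ∀ z ∈ B, IsGeodesic n fun r ↦ Φ (r, z))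
    (hunit : ∀ z ∈ B, inducedForm n Φ (1, 0) (1, 0) (0, z) = 1)
    (hnormal : ∀ z ∈ B, ∀ e : X, inducedForm n Φ (1, 0) (0, e) (0, z) = 0) :
    ∀ r, ∀ z ∈ B, ∀ e : X, inducedForm n Φ (1, 0) (0, e) (r, z) = 0 := by
  -- Constant speed: the radial derivative of `|∂_r Φ|²` is `2 ⟨∇_r ∂_r Φ, ∂_r Φ⟩`, which vanishes
  -- along geodesics.
  have hone : ∀ r, ∀ z ∈ B, inducedForm n Φ (1, 0) (1, 0) (r, z) = 1 := by
    intro r z hz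
    refine Eq.trans ?_ (hunit z hz)
    refine is_const_of_deriv_eq_zero (f := fun s ↦ inducedForm n Φ (1, 0) (1, 0) (s, z))
      (fun s ↦ (hasDerivAt_inducedForm_slice n hB hΦ s hz _ _).differentiableAt) (fun s ↦ ?_) r 0
    rw [(hasDerivAt_inducedForm_slice n hB hΦ s hz _ _).deriv,
      fderiv_inducedForm n (eventually_contMDiffAt n hB hΦ s hz) (mem_chart_source _ _) rfl,
      radial_acceleration_eq_zero n (hΦ s z hz) (hgeo z hz) (mem_chart_source _ _) rfl]
    simp
  intro r z hz e
  refine Eq.trans ?_ (hnormal z hz e)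
  refine is_const_of_deriv_eq_zero (f := fun s ↦ inducedForm n Φ (1, 0) (0, e) (s, z))
      (fun s ↦ (hasDerivAt_inducedForm_slice n hB hΦ s hz _ _).differentiableAt) (fun s ↦ ?_) r 0
  have hev := eventually_contMDiffAt n hB hΦ s hz
  have hconst : inducedForm n Φ (1, 0) (1, 0) =ᶠ[𝓝 (s, z)] fun _ ↦ 1 := by
    filter_upwards [continuous_snd.continuousAt (hB.mem_nhds hz)] with x hx using hone x.1 x.2 hx
  -- Differentiating `|∂_r Φ|² = 1` along `e` gives `⟨∇_e ∂_r Φ, ∂_r Φ⟩ = 0`. As the connection is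
  -- torsion-free, this is the remaining term in the radial derivative of `⟨∂_r Φ, ∂_e Φ⟩`.
  have h1 : fderiv ℝ (inducedForm n Φ (1, 0) (1, 0)) (s, z) (0, e) = 0 := by
    rw [hconst.fderiv_eq]; simp
  rw [(hasDerivAt_inducedForm_slice n hB hΦ s hz _ _).deriv,
    fderiv_inducedForm n hev (mem_chart_source _ _) rfl,
    radial_acceleration_eq_zero n (hΦ s z hz) (hgeo z hz) (mem_chart_source _ _) rfl,
    covariantDeriv_comm n hev (mem_chart_source _ _) rfl (1, 0) (0, e)]
  rw [fderiv_inducedForm n hev (mem_chart_source _ _) rfl, metricForm_comm, ← two_mul] at h1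
  simpa using h1

/-- The first variation formula for the metrics induced by the maps `Φ (r, ·)`. -/
lemma fderiv_inducedForm_radial (hB : IsOpen B)
    (hΦ : ∀ r, ∀ z ∈ B, ContMDiffAt 𝓘(ℝ, ℝ × X) (𝓡 n) ∞ Φ (r, z))
    (hgauss : ∀ r, ∀ z ∈ B, ∀ e : X, inducedForm n Φ (1, 0) (0, e) (r, z) = 0)
    {r : ℝ} {a : X} (ha : a ∈ B) {p : N}
    (hp : Φ (r, a) ∈ (chartAt (EuclideanSpace ℝ (Fin n)) p).source)
    {F : ℝ × X → EuclideanSpace ℝ (Fin n)} (hF : F = fun z ↦ extChartAt (𝓡 n) p (Φ z)) (u v : X) :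
    fderiv ℝ (inducedForm n Φ (0, u) (0, v)) (r, a) (1, 0) =
      -2 * metricForm n p (F (r, a)) (fderiv ℝ (fderiv ℝ F) (r, a) (0, u) (0, v)
        + christoffelForm n p (F (r, a)) (fderiv ℝ F (r, a) (0, u)) (fderiv ℝ F (r, a) (0, v)))
        (fderiv ℝ F (r, a) (1, 0)) := by
  have hev := eventually_contMDiffAt n hB hΦ r ha
  -- Differentiating the Gauss relation `⟨∂_r Φ, ∂_v Φ⟩ = 0` along `u` moves the derivative from the
  -- radial field to the slice. Both halves of the derivative of the metric are of this kind, whence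
  -- the factor `-2`.
  have key : ∀ u v : X, metricForm n p (F (r, a)) (fderiv ℝ (fderiv ℝ F) (r, a) (0, u) (1, 0)
        + christoffelForm n p (F (r, a)) (fderiv ℝ F (r, a) (0, u)) (fderiv ℝ F (r, a) (1, 0)))
        (fderiv ℝ F (r, a) (0, v)) =
      - metricForm n p (F (r, a)) (fderiv ℝ F (r, a) (1, 0))
        (fderiv ℝ (fderiv ℝ F) (r, a) (0, u) (0, v)
        + christoffelForm n p (F (r, a)) (fderiv ℝ F (r, a) (0, u))
          (fderiv ℝ F (r, a) (0, v))) := fun u v ↦ by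
    have hconst : inducedForm n Φ (1, 0) (0, v) =ᶠ[𝓝 (r, a)] fun _ ↦ 0 := by
      filter_upwards [continuous_snd.continuousAt (hB.mem_nhds ha)] with x hx
        using hgauss x.1 x.2 hx v
    have h1 : fderiv ℝ (inducedForm n Φ (1, 0) (0, v)) (r, a) (0, u) = 0 := by
      rw [hconst.fderiv_eq]; simp
    rw [fderiv_inducedForm n hev hp hF] at h1
    exact eq_neg_of_add_eq_zero_left h1
  rw [fderiv_inducedForm n hev hp hF, metricForm_comm n p _ (fderiv ℝ F (r, a) (0, u)),
    covariantDeriv_comm n hev hp hF (1, 0) (0, u), covariantDeriv_comm n hev hp hF (1, 0) (0, v),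
    key, key, covariantDeriv_comm n hev hp hF (0, v) (0, u), metricForm_comm]
  ring

/-- If the volume of the hypersurfaces `Φ (r, ·)` increases at `r = ρ a`, then the graph
`z ↦ Φ (ρ z, z)` over a local maximum `a` of `ρ` has mean curvature with negative radial
component. -/
lemma exists_normal_of_deriv_volume_pos {m : ℕ} (hB : IsOpen B)
    (hΦ : ∀ r, ∀ z ∈ B, ContMDiffAt 𝓘(ℝ, ℝ × X) (𝓡 n) ∞ Φ (r, z))
    (hgauss : ∀ r, ∀ z ∈ B, ∀ e : X, inducedForm n Φ (1, 0) (0, e) (r, z) = 0)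
    {a : X} (ha : a ∈ B) {ρ : X → ℝ} (hρ : ContDiffAt ℝ 2 ρ a) (hmax : IsLocalMax ρ a)
    {φ : X → N} (hφd : ∀ᶠ z in 𝓝 a, ContMDiffAt 𝓘(ℝ, X) (𝓡 n) ∞ φ z)
    (hφ : φ =ᶠ[𝓝 a] fun z ↦ Φ (ρ z, z)) (e : Fin m → X)
    (hvol : 0 < deriv (fun s ↦ √(Matrix.of fun i j ↦
      inducedForm n Φ (0, e i) (0, e j) (s, a)).det) (ρ a))
    {F : X → EuclideanSpace ℝ (Fin n)} (hF : F = fun z ↦ extChartAt (𝓡 n) (φ a) (φ z)) :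
    ∃ T : EuclideanSpace ℝ (Fin n),
      (∀ v, metricForm n (φ a) (F a) (fderiv ℝ F a v) T = 0) ∧
      ∑ i, ∑ j, (Matrix.of fun i j ↦ inducedForm n φ (e i) (e j) a)⁻¹ i j *
        metricForm n (φ a) (F a) (fderiv ℝ (fderiv ℝ F) a (e i) (e j)
          + christoffelForm n (φ a) (F a) (fderiv ℝ F a (e i)) (fderiv ℝ F a (e j))) T < 0 := by
  have hφa : φ a = Φ (ρ a, a) := hφ.self_of_nhds
  have hp : Φ (ρ a, a) ∈ (chartAt (EuclideanSpace ℝ (Fin n)) (φ a)).source := by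
    rw [hφa]; exact mem_chart_source _ _
  set G : ℝ × X → EuclideanSpace ℝ (Fin n) := fun z ↦ extChartAt (𝓡 n) (φ a) (Φ z) with hG
  have hGd : ContDiffAt ℝ ∞ G (ρ a, a) := contDiffAt_extChartAt_comp n (hΦ _ a ha) hp
  have hFG : F =ᶠ[𝓝 a] fun z ↦ G (ρ z, z) := by
    filter_upwards [hφ] with z hz
    rw [hF, hG]; simp only [hz]
  -- Since `dρ = 0` at `a`, the graph and the slice `r = ρ a` have the same first derivative, and
  -- their second derivatives differ by `Hess ρ` times the radial one.
  have hd := fun v w ↦ fderiv_graph (hGd.of_le (by norm_cast)) hρ hmax.fderiv_eq_zero v w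
  rw [← hFG.fderiv_eq, ← hFG.fderiv.fderiv_eq] at hd
  have hFa : F a = G (ρ a, a) := hFG.self_of_nhds
  have hev := eventually_contMDiffAt n hB hΦ (ρ a) ha
  have hTn : ∀ v, metricForm n (φ a) (G (ρ a, a)) (fderiv ℝ G (ρ a, a) (1, 0))
      (fderiv ℝ G (ρ a, a) (0, v)) = 0 := fun v ↦ by
    exact (inducedForm_eventuallyEq n hev hp hG (1, 0) (0, v)).self_of_nhds.symm.trans
      (hgauss (ρ a) a ha v)
  set A : ℝ → Matrix (Fin m) (Fin m) ℝ := fun s ↦ Matrix.of fun i j ↦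
      inducedForm n Φ (0, e i) (0, e j) (s, a) with hA
  have hAφ : (Matrix.of fun i j ↦ inducedForm n φ (e i) (e j) a) = A (ρ a) := by
    ext i j
    simp only [hA, Matrix.of_apply]
    refine (inducedForm_eventuallyEq n hφd (mem_chart_source _ _) hF (e i) (e j)).self_of_nhds.trans
      (Eq.trans ?_ (inducedForm_eventuallyEq n hev hp hG (0, e i) (0, e j)).self_of_nhds.symm)
    change metricForm n (φ a) (F a) (fderiv ℝ F a (e i)) (fderiv ℝ F a (e j)) =
      metricForm n (φ a) (G (ρ a, a)) (fderiv ℝ G (ρ a, a) (0, e i)) (fderiv ℝ G (ρ a, a) (0, e j))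
    rw [hFa, (hd 0 _).1, (hd 0 _).1]
  have hps : (A (ρ a)).PosSemidef :=
    Matrix.posSemidef_gram (E := TangentSpace (𝓡 n) (Φ (ρ a, a))) ℝ
      (fun i ↦ mfderiv 𝓘(ℝ, ℝ × X) (𝓡 n) Φ (ρ a, a) (0, e i))
  set T := fderiv ℝ G (ρ a, a) (1, 0) with hT
  have hsum := sum_inv_mul_pos_of_deriv_sqrt_det_pos (A := A)
    (A' := Matrix.of fun i j ↦ fderiv ℝ (inducedForm n Φ (0, e i) (0, e j)) (ρ a, a) (1, 0))
    (fun i j ↦ hasDerivAt_inducedForm_slice n hB hΦ (ρ a) ha (0, e i) (0, e j)) hps hvol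
  have hTT : 0 ≤ metricForm n (φ a) (G (ρ a, a)) T T := by
    rw [metricForm_eq_innerAt]
    exact real_inner_self_nonneg (F := TangentSpace (𝓡 n) _)
  have hhess : ∑ i, ∑ j, (A (ρ a))⁻¹ i j * fderiv ℝ (fderiv ℝ ρ) a (e i) (e j) ≤ 0 :=
    sum_posSemidef_mul_nonpos hps.inv
      ((ContinuousLinearMap.coeLM ℝ).comp (fderiv ℝ (fderiv ℝ ρ) a).toLinearMap)
      (fun v ↦ fderiv_fderiv_nonpos_of_isLocalMax hmax hρ v) e
  -- The witness is the radial velocity, normal to the slice by the Gauss lemma and hence to the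
  -- graph.
  refine ⟨T, fun v ↦ ?_, ?_⟩
  · rw [hFa, (hd 0 v).1, metricForm_comm, hTn]
  rw [hAφ]
  set H : Fin m → Fin m → ℝ := fun i j ↦ metricForm n (φ a) (G (ρ a, a))
    (fderiv ℝ (fderiv ℝ G) (ρ a, a) (0, e i) (0, e j) + christoffelForm n (φ a) (G (ρ a, a))
      (fderiv ℝ G (ρ a, a) (0, e i)) (fderiv ℝ G (ρ a, a) (0, e j))) T with hH
  have h1 : ∀ i j, metricForm n (φ a) (F a) (fderiv ℝ (fderiv ℝ F) a (e i) (e j)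
      + christoffelForm n (φ a) (F a) (fderiv ℝ F a (e i)) (fderiv ℝ F a (e j))) T =
      H i j + fderiv ℝ (fderiv ℝ ρ) a (e i) (e j) * metricForm n (φ a) (G (ρ a, a)) T T := by
    intro i j
    rw [hFa, (hd (e i) (e j)).2, (hd 0 _).1, (hd 0 _).1, add_right_comm, map_add, add_apply,
      map_smul, smul_apply, smul_eq_mul]
  -- The indices are swapped because the logarithmic derivative of the determinant is the trace of
  -- `A⁻¹ A'`, which pairs entry `(i, j)` with `(j, i)`.
  have h2 : ∀ i j, fderiv ℝ (inducedForm n Φ (0, e j) (0, e i)) (ρ a, a) (1, 0) = -2 * H i j := by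
    intro i j
    rw [fderiv_inducedForm_radial n hB hΦ hgauss ha hp hG, covariantDeriv_comm n hev hp hG]
  simp only [Matrix.of_apply, h2] at hsum
  simp only [h1]
  have h3 : ∑ i, ∑ j, (A (ρ a))⁻¹ i j * (-2 * H i j) =
      -2 * ∑ i, ∑ j, (A (ρ a))⁻¹ i j * H i j := by
    simp only [Finset.mul_sum]
    exact Finset.sum_congr rfl fun i _ ↦ Finset.sum_congr rfl fun j _ ↦ by ring
  have h4 : ∑ i, ∑ j, (A (ρ a))⁻¹ i j * (H i j + fderiv ℝ (fderiv ℝ ρ) a (e i) (e j) *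
        metricForm n (φ a) (G (ρ a, a)) T T) = ∑ i, ∑ j, (A (ρ a))⁻¹ i j * H i j +
      (∑ i, ∑ j, (A (ρ a))⁻¹ i j * fderiv ℝ (fderiv ℝ ρ) a (e i) (e j)) *
        metricForm n (φ a) (G (ρ a, a)) T T := by
    simp only [Finset.sum_mul, ← Finset.sum_add_distrib]
    exact Finset.sum_congr rfl fun i _ ↦ Finset.sum_congr rfl fun j _ ↦ by ring
  rw [h3] at hsum
  rw [h4]
  -- The slice contributes strictly negatively, by the volume hypothesis, and the Hessian of `ρ`
  -- contributes at most `0`.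
  have := mul_nonpos_of_nonpos_of_nonneg hhess hTT
  linarith

end Comparison
end NormalExp
end

noncomputable section


namespace NormalExp

/-! ### Inverse function theorem on manifolds -/

section InverseFunction

/-- The inverse function theorem, for a map between open subsets of a Euclidean space with
everywhere injective derivative. -/
lemma exists_partialDiffeomorph_of_fderiv_injective {m : ℕ}
    {g : EuclideanSpace ℝ (Fin m) → EuclideanSpace ℝ (Fin m)} {D : Set (EuclideanSpace ℝ (Fin m))}
    (hD : IsOpen D) (hg : ∀ z ∈ D, ContDiffAt ℝ ∞ g z)
    (hinj : ∀ z ∈ D, Function.Injective (fderiv ℝ g z)) {a : EuclideanSpace ℝ (Fin m)}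
    (ha : a ∈ D) : ∃ h : PartialDiffeomorph (𝓡 m) (𝓡 m) (EuclideanSpace ℝ (Fin m))
      (EuclideanSpace ℝ (Fin m)) ∞, a ∈ h.source ∧ h.source ⊆ D ∧ ∀ z, h z = g z := by
  have hequiv : ∀ z ∈ D, ∃ L : EuclideanSpace ℝ (Fin m) ≃L[ℝ] EuclideanSpace ℝ (Fin m),
      HasFDerivAt g (L : EuclideanSpace ℝ (Fin m) →L[ℝ] EuclideanSpace ℝ (Fin m)) z := by
    intro z hz
    refine ⟨(LinearEquiv.ofInjectiveEndo (fderiv ℝ g z).toLinearMap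
      (hinj z hz)).toContinuousLinearEquiv, ?_⟩
    exact ((hg z hz).differentiableAt (by simp)).hasFDerivAt
  obtain ⟨L, hL⟩ := hequiv a ha
  -- After restriction to `D` the derivative is invertible at every source point, so the inverse is
  -- smooth on the whole target and not merely at `g a`.
  set h := ((hg a ha).toOpenPartialHomeomorph g hL (by simp)).restrOpen D hD with hh
  have hsrc : h.source ⊆ D := fun z hz ↦ hz.2
  refine ⟨⟨h.toPartialEquiv, h.open_source, h.open_target, ?_, ?_⟩,
    ⟨(hg a ha).mem_toOpenPartialHomeomorph_source hL (by simp), ha⟩, hsrc, fun z ↦ rfl⟩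
  · exact contMDiffOn_iff_contDiffOn.2 fun z hz ↦ (hg z (hsrc hz)).contDiffWithinAt
  · refine contMDiffOn_iff_contDiffOn.2 fun z hz ↦ ContDiffAt.contDiffWithinAt ?_
    have hz' : h.symm z ∈ D := hsrc (h.map_target hz)
    obtain ⟨L', hL'⟩ := hequiv _ hz'
    exact h.contDiffAt_symm hz hL' (hg _ hz')

variable {m : ℕ} {M : Type*} [TopologicalSpace M] [ChartedSpace (EuclideanSpace ℝ (Fin m)) M]
  [IsManifold (𝓡 m) ∞ M]

/-- A chart, as a partial diffeomorphism. -/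
def chartPartialDiffeomorph (x : M) :
    PartialDiffeomorph (𝓡 m) (𝓡 m) M (EuclideanSpace ℝ (Fin m)) ∞ where
  toPartialEquiv := (chartAt (EuclideanSpace ℝ (Fin m)) x).toPartialEquiv
  open_source := (chartAt (EuclideanSpace ℝ (Fin m)) x).open_source
  open_target := (chartAt (EuclideanSpace ℝ (Fin m)) x).open_target
  contMDiffOn_toFun := contMDiffOn_chart
  contMDiffOn_invFun := contMDiffOn_chart_symm

/-- The derivative of a map out of `M`, in a chart. -/
lemma mfderiv_comp_extChartAt_symm {n : ℕ} {N : Type*} [TopologicalSpace N]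
    [ChartedSpace (EuclideanSpace ℝ (Fin n)) N] {φ : M → N} {x : M}
    {z : EuclideanSpace ℝ (Fin m)} (hz : z ∈ (extChartAt (𝓡 m) x).target)
    (hφ : MDifferentiableAt (𝓡 m) (𝓡 n) φ ((extChartAt (𝓡 m) x).symm z)) :
    (mfderiv (𝓡 m) (𝓡 n) (fun z ↦ φ ((extChartAt (𝓡 m) x).symm z)) z :
      EuclideanSpace ℝ (Fin m) →L[ℝ] EuclideanSpace ℝ (Fin n)) =
    (mfderiv (𝓡 m) (𝓡 n) φ ((extChartAt (𝓡 m) x).symm z) :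
      EuclideanSpace ℝ (Fin m) →L[ℝ] EuclideanSpace ℝ (Fin n)).comp (chartSymmDeriv m x z) :=
  mfderiv_comp z hφ (mdifferentiableAt_extChartAt_symm m hz)

lemma mfderiv_comp_extChartAt_symm_self {n : ℕ} {N : Type*} [TopologicalSpace N]
    [ChartedSpace (EuclideanSpace ℝ (Fin n)) N] {φ : M → N} {y : M}
    {a : EuclideanSpace ℝ (Fin m)} (ha : a = extChartAt (𝓡 m) y y)
    (hφ : MDifferentiableAt (𝓡 m) (𝓡 n) φ y) :
    (mfderiv (𝓡 m) (𝓡 n) (fun z ↦ φ ((extChartAt (𝓡 m) y).symm z)) a :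
      EuclideanSpace ℝ (Fin m) →L[ℝ] EuclideanSpace ℝ (Fin n)) = mfderiv (𝓡 m) (𝓡 n) φ y := by
  have hya : (extChartAt (𝓡 m) y).symm a = y := by rw [ha, extChartAt_to_inv]
  have hbase : ∀ q q' : M, q = q' →
      (mfderiv (𝓡 m) (𝓡 n) φ q : EuclideanSpace ℝ (Fin m) →L[ℝ] EuclideanSpace ℝ (Fin n)) =
        mfderiv (𝓡 m) (𝓡 n) φ q' := by rintro q _ rfl; rfl
  have h := mfderiv_comp_extChartAt_symm (x := y) (z := a) (ha ▸ mem_extChartAt_target y)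
    (hya.symm ▸ hφ)
  rw [hbase _ _ hya] at h
  rw [show chartSymmDeriv m y a = ContinuousLinearMap.id ℝ _ from ha ▸ chartSymmDeriv_self m y] at h
  exact h.trans (ContinuousLinearMap.comp_id _)

lemma chartSymmDeriv_surjective {x : M} {z : EuclideanSpace ℝ (Fin m)}
    (hz : z ∈ (extChartAt (𝓡 m) x).target) : Function.Surjective (chartSymmDeriv m x z) :=
  LinearMap.surjective_of_injective (f := (chartSymmDeriv m x z).toLinearMap)
    (chartSymmDeriv_injective m hz)

lemma contMDiffAt_comp_extChartAt_symm {n : ℕ} {N : Type*} [TopologicalSpace N]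
    [ChartedSpace (EuclideanSpace ℝ (Fin n)) N] {φ : M → N} {x : M}
    {z : EuclideanSpace ℝ (Fin m)} (hz : z ∈ (extChartAt (𝓡 m) x).target)
    (hφ : ContMDiffAt (𝓡 m) (𝓡 n) ∞ φ ((extChartAt (𝓡 m) x).symm z)) :
    ContMDiffAt (𝓡 m) (𝓡 n) ∞ (fun z ↦ φ ((extChartAt (𝓡 m) x).symm z)) z :=
  hφ.comp z (((contMDiffOn_extChartAt_symm_target m x) z hz).contMDiffAt
    ((isOpen_extChartAt_target x).mem_nhds hz))

/-- A smooth map between manifolds of the same dimension with surjective derivatives is a local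
diffeomorphism. -/
lemma isLocalDiffeomorph_of_mfderiv_surjective {M' : Type*} [TopologicalSpace M']
    [ChartedSpace (EuclideanSpace ℝ (Fin m)) M'] [IsManifold (𝓡 m) ∞ M'] {α : M → M'}
    (hα : ContMDiff (𝓡 m) (𝓡 m) ∞ α)
    (hsurj : ∀ y, Function.Surjective (mfderiv (𝓡 m) (𝓡 m) α y)) :
    IsLocalDiffeomorph (𝓡 m) (𝓡 m) ∞ α := by
  intro y
  set c := extChartAt (𝓡 m) y with hc
  set c' := extChartAt (𝓡 m) (α y) with hc'
  set D : Set (EuclideanSpace ℝ (Fin m)) :=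
    c.target ∩ c.symm ⁻¹' (α ⁻¹' (chartAt (EuclideanSpace ℝ (Fin m)) (α y)).source) with hD
  have hDo : IsOpen D := (contMDiffOn_extChartAt_symm_target m y).continuousOn.isOpen_inter_preimage
    (isOpen_extChartAt_target y)
    ((chartAt (EuclideanSpace ℝ (Fin m)) (α y)).open_source.preimage hα.continuous)
  have hcomp : ∀ z ∈ D, ContMDiffAt (𝓡 m) (𝓡 m) ∞ (fun z ↦ α (c.symm z)) z := fun z hz ↦
    contMDiffAt_comp_extChartAt_symm hz.1 (hα _)
  have hyD : c y ∈ D := by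
    refine ⟨mem_extChartAt_target y, ?_⟩
    simp [hc]
  have hinj : ∀ z ∈ D, Function.Injective (fderiv ℝ (fun z ↦ c' (α (c.symm z))) z) := by
    intro z hz
    have h1 := mfderiv_eq_chartSymmDeriv_comp m (hcomp z hz) hz.2
    have h2 := mfderiv_comp_extChartAt_symm hz.1 ((hα (c.symm z)).mdifferentiableAt (by simp))
    have hs : Function.Surjective ((mfderiv (𝓡 m) (𝓡 m) α (c.symm z) :
      EuclideanSpace ℝ (Fin m) →L[ℝ] EuclideanSpace ℝ (Fin m)).comp (chartSymmDeriv m y z)) :=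
      (hsurj _).comp (chartSymmDeriv_surjective hz.1)
    rw [← h2, h1] at hs
    -- Here the equality of dimensions enters: a surjective endomorphism of the model space is
    -- injective.
    have hi := LinearMap.injective_iff_surjective.2 hs
    exact Function.Injective.of_comp hi
  obtain ⟨h, hh, hsub, heq⟩ := exists_partialDiffeomorph_of_fderiv_injective
    (g := fun z ↦ c' (α (c.symm z))) hDo
    (fun z hz ↦ contDiffAt_extChartAt_comp m (hcomp z hz) hz.2) hinj hyD
  · refine ⟨((chartPartialDiffeomorph y).trans h).trans (chartPartialDiffeomorph (α y)).symm, ?_, ?_⟩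
    · refine ⟨⟨mem_chart_source _ y, hh⟩, ?_⟩
      change h (c y) ∈ (chartAt (EuclideanSpace ℝ (Fin m)) (α y)).target
      rw [heq, hc, extChartAt_to_inv]
      exact mem_chart_target _ _
    · rintro x ⟨⟨hx1, hx2⟩, -⟩
      have hx3 : c x ∈ D := hsub hx2
      have hx4 : c.symm (c x) = x := c.left_inv ((extChartAt_source (𝓡 m) y).symm ▸ hx1)
      change α x = c'.symm (h (c x))
      rw [heq, hx4, c'.left_inv]
      have := hx3.2
      simpa [hx4, hc'] using this

end InverseFunction
end NormalExp
end

noncomputable section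


namespace NormalExp

/-! ### Scaling in the tangent bundle -/

section TangentScaling

variable {n : ℕ} {N : Type*} [TopologicalSpace N] [ChartedSpace (EuclideanSpace ℝ (Fin n)) N]
  [IsManifold (𝓡 n) ∞ N]

/-- Trivialisations are linear on fibres, so in them the map is scalar multiplication, jointly
smooth in scalar and vector. -/
lemma contMDiff_smul_tangentBundle :
    ContMDiff (𝓘(ℝ, ℝ).prod (𝓡 n).tangent) (𝓡 n).tangent ∞
      (fun z : ℝ × TangentBundle (𝓡 n) N ↦ (⟨z.2.proj, z.1 • z.2.2⟩ : TangentBundle (𝓡 n) N)) := by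
  rintro ⟨r₀, V₀⟩
  have hsnd : ContMDiffAt (𝓘(ℝ, ℝ).prod (𝓡 n).tangent) (𝓡 n).tangent ∞
      (fun z : ℝ × TangentBundle (𝓡 n) N ↦ z.2) (r₀, V₀) := contMDiffAt_snd
  have hsnd' := contMDiffAt_totalSpace.1 hsnd
  rw [contMDiffAt_totalSpace]
  refine ⟨hsnd'.1, ?_⟩
  have hfst : ContMDiffAt (𝓘(ℝ, ℝ).prod (𝓡 n).tangent) 𝓘(ℝ, ℝ) ∞
      (fun z : ℝ × TangentBundle (𝓡 n) N ↦ z.1) (r₀, V₀) := contMDiffAt_fst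
  refine (hfst.smul hsnd'.2).congr_of_eventuallyEq ?_
  have hb : (trivializationAt (EuclideanSpace ℝ (Fin n)) (TangentSpace (𝓡 n)) V₀.proj).baseSet ∈
      𝓝 V₀.proj := (trivializationAt _ _ V₀.proj).open_baseSet.mem_nhds (mem_baseSet_trivializationAt _ _ _)
  filter_upwards [hsnd'.1.continuousAt hb] with z hz
  exact ((trivializationAt (EuclideanSpace ℝ (Fin n)) (TangentSpace (𝓡 n)) V₀.proj).linear ℝ hz).map_smul z.1 z.2.2

end TangentScaling

/-! ### The normal bundle and transversality of `f` -/

section NormalBundle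

variable (m n : ℕ)
  {M : Type*} [TopologicalSpace M] [ChartedSpace (EuclideanSpace ℝ (Fin m)) M]
  {N : Type*} [TopologicalSpace N] [ChartedSpace (EuclideanSpace ℝ (Fin n)) N] [IsManifold (𝓡 n) ∞ N]
  [RiemannianBundle (fun x : N ↦ TangentSpace (𝓡 n) x)]

lemma mem_normalSpace_iff {φ : M → N} {x : M} {v : TangentSpace (𝓡 n) (φ x)} :
    v ∈ normalSpace m n φ x ↔
      ∀ u, innerAt n (φ x) (mfderiv (𝓡 m) (𝓡 n) φ x u) v = 0 := by
  rw [normalSpace, Submodule.mem_orthogonal]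
  constructor
  · exact fun h u ↦ h _ ⟨u, rfl⟩
  · rintro h _ ⟨u, rfl⟩
    exact h u

lemma mem_normalBundle_iff {f : M → N} {P : M × TangentBundle (𝓡 n) N} :
    P ∈ normalBundle m n f ↔ P.2.proj = f P.1 ∧
      ∀ u, innerAt n (f P.1) (mfderiv (𝓡 m) (𝓡 n) f P.1 u) P.2.2 = 0 := by
  obtain ⟨x, q, v⟩ := P
  constructor
  · rintro ⟨x', v', hv', h⟩
    obtain ⟨rfl, h2⟩ := Prod.mk.inj h
    obtain ⟨rfl, h3⟩ := TotalSpace.mk.inj h2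
    obtain rfl := eq_of_heq h3
    exact ⟨rfl, (mem_normalSpace_iff m n).1 hv'⟩
  · rintro ⟨h1, h2⟩
    change q = f x at h1
    subst h1
    exact ⟨x, v, (mem_normalSpace_iff m n).2 h2, rfl⟩

lemma smul_mem_normalBundle {f : M → N} {P : M × TangentBundle (𝓡 n) N}
    (hP : P ∈ normalBundle m n f) (r : ℝ) :
    (P.1, (⟨P.2.proj, r • P.2.2⟩ : TangentBundle (𝓡 n) N)) ∈ normalBundle m n f := by
  obtain ⟨x, v, hv, rfl⟩ := hP
  exact ⟨x, r • v, Submodule.smul_mem _ r hv, rfl⟩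

lemma mk_mem_normalBundle {f : M → N} {x : M} {v : TangentSpace (𝓡 n) (f x)}
    (hv : v ∈ normalSpace m n f x) :
    (x, (⟨f x, v⟩ : TangentBundle (𝓡 n) N)) ∈ normalBundle m n f := ⟨x, v, hv, rfl⟩

/-- An immersion with smooth normal exponential map is transverse to the fibres. -/
lemma transverseToFibres_self [T2Space N]
    [IsContMDiffRiemannianBundle (𝓡 n) ∞ (EuclideanSpace ℝ (Fin n))
      (fun x : N ↦ TangentSpace (𝓡 n) x)] {f : M → N}
    (hdef : ∀ P ∈ normalBundle m n f, P.2 ∈ expDomain n) : TransverseToFibres m n f f := by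
  intro y
  have : FiniteDimensional ℝ (TangentSpace (𝓡 n) (f y)) :=
    inferInstanceAs (FiniteDimensional ℝ (EuclideanSpace ℝ (Fin n)))
  refine eq_top_iff.2 ((Submodule.sup_orthogonal_of_hasOrthogonalProjection
    (K := LinearMap.range (mfderiv (𝓡 m) (𝓡 n) f y).toLinearMap)).ge.trans
    (sup_le_sup_left (fun w hw ↦ Submodule.subset_span ?_) _))
  -- With foot vector `0`, the curve `t ↦ exp (t w)` has velocity `w`, so the fibre tangent space at
  -- `f y` contains the whole normal space.
  refine ⟨y, 0, Submodule.zero_mem _, w, hw, ?_⟩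
  simp only [zero_add]
  exact (isGeodesic_expMap_smul n (hdef _ (mk_mem_normalBundle m n hw))).2

end NormalBundle

/-! ### Projection along the fibres, a submersion -/

section Retraction

variable {m n : ℕ}
  {M : Type*} [TopologicalSpace M] [ChartedSpace (EuclideanSpace ℝ (Fin m)) M]
  {N : Type*} [TopologicalSpace N] [T2Space N] [ChartedSpace (EuclideanSpace ℝ (Fin n)) N]
  [IsManifold (𝓡 n) ∞ N] [RiemannianBundle (fun x : N ↦ TangentSpace (𝓡 n) x)]
  [IsContMDiffRiemannianBundle (𝓡 n) ∞ (EuclideanSpace ℝ (Fin n))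
      (fun x : N ↦ TangentSpace (𝓡 n) x)]

/-- A smooth inverse `N → TM^⊥` of the normal exponential map of `f`. -/
structure IsNormalExpInverse (m n : ℕ)
    {M : Type*} [TopologicalSpace M] [ChartedSpace (EuclideanSpace ℝ (Fin m)) M]
    {N : Type*} [TopologicalSpace N] [ChartedSpace (EuclideanSpace ℝ (Fin n)) N]
    [IsManifold (𝓡 n) ∞ N] [RiemannianBundle (fun x : N ↦ TangentSpace (𝓡 n) x)]
    (f : M → N) (σ : N → M × TangentBundle (𝓡 n) N) : Prop where
  contMDiff : ContMDiff (𝓡 n) ((𝓡 m).prod (𝓡 n).tangent) ∞ σ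
  mem : ∀ q, σ q ∈ normalBundle m n f
  exp_inverse : ∀ q, expMap n (σ q).2 = q
  inverse_exp : ∀ P ∈ normalBundle m n f, σ (expMap n P.2) = P

variable {f : M → N} {σ : N → M × TangentBundle (𝓡 n) N}

namespace IsNormalExpInverse

lemma proj_eq (hσ : IsNormalExpInverse m n f σ) (q : N) : (σ q).2.proj = f (σ q).1 :=
  ((mem_normalBundle_iff m n).1 (hσ.mem q)).1

lemma contMDiff_fst (hσ : IsNormalExpInverse m n f σ) :
    ContMDiff (𝓡 n) (𝓡 m) ∞ (fun q ↦ (σ q).1) :=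
  ContMDiff.comp (I' := (𝓡 m).prod (𝓡 n).tangent) _root_.contMDiff_fst hσ.contMDiff

lemma contMDiff_snd (hσ : IsNormalExpInverse m n f σ) :
    ContMDiff (𝓡 n) (𝓡 n).tangent ∞ (fun q ↦ (σ q).2) :=
  ContMDiff.comp (I' := (𝓡 m).prod (𝓡 n).tangent) _root_.contMDiff_snd hσ.contMDiff

lemma apply_image (hσ : IsNormalExpInverse m n f σ) (x : M) : σ (f x) = (x, ⟨f x, 0⟩) := by
  have h := hσ.inverse_exp _ (mk_mem_normalBundle m n (f := f) (x := x) (Submodule.zero_mem _))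
  rwa [expMap_zero] at h

/-- The dilation of `N` along the fibres of the normal exponential map. -/
def dilation (n : ℕ) {N : Type*} [TopologicalSpace N] [ChartedSpace (EuclideanSpace ℝ (Fin n)) N]
    [IsManifold (𝓡 n) ∞ N] [RiemannianBundle (fun x : N ↦ TangentSpace (𝓡 n) x)]
    (σ : N → M × TangentBundle (𝓡 n) N) (r : ℝ) (q : N) : N :=
  expMap n (⟨(σ q).2.proj, r • (σ q).2.2⟩ : TangentBundle (𝓡 n) N)

/-- In the coordinates of `TM^⊥` given by `σ`, dilation fixes the base point and scales the normal
vector; its composition law follows. -/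
lemma inverse_dilation (hσ : IsNormalExpInverse m n f σ) (r : ℝ) (q : N) :
    σ (dilation n σ r q) = ((σ q).1, ⟨(σ q).2.proj, r • (σ q).2.2⟩) :=
  hσ.inverse_exp _ (smul_mem_normalBundle m n (hσ.mem q) r)

lemma dilation_dilation (hσ : IsNormalExpInverse m n f σ) (r s : ℝ) (q : N) :
    dilation n σ r (dilation n σ s q) = dilation n σ (r * s) q := by
  rw [dilation, hσ.inverse_dilation, dilation, mul_smul]

lemma dilation_one (hσ : IsNormalExpInverse m n f σ) (q : N) : dilation n σ 1 q = q := by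
  rw [dilation, one_smul]
  exact hσ.exp_inverse q

lemma dilation_zero (hσ : IsNormalExpInverse m n f σ) (q : N) :
    dilation n σ 0 q = f (σ q).1 := by
  rw [dilation, zero_smul, expMap_zero, hσ.proj_eq]

/-- `expMap` is known to be smooth only along `TM^⊥`, but `TM^⊥` is stable under scaling, so the
composition never leaves it. -/
lemma contMDiff_dilation (hσ : IsNormalExpInverse m n f σ)
    (hsmooth : ContMDiffOn ((𝓡 m).prod (𝓡 n).tangent) (𝓡 n) ∞
      (fun P : M × TangentBundle (𝓡 n) N ↦ expMap n P.2) (normalBundle m n f)) :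
    ContMDiff (𝓘(ℝ, ℝ).prod (𝓡 n)) (𝓡 n) ∞ (fun z : ℝ × N ↦ dilation n σ z.1 z.2) := by
  have h1 : ContMDiff (𝓘(ℝ, ℝ).prod (𝓡 n)) ((𝓡 m).prod (𝓡 n).tangent) ∞
      (fun z : ℝ × N ↦ ((σ z.2).1, (⟨(σ z.2).2.proj, z.1 • (σ z.2).2.2⟩ : TangentBundle (𝓡 n) N))) := by
    refine (hσ.contMDiff_fst.comp _root_.contMDiff_snd).prodMk ?_
    exact contMDiff_smul_tangentBundle.comp
      (_root_.contMDiff_fst.prodMk (hσ.contMDiff_snd.comp _root_.contMDiff_snd))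
  exact hsmooth.comp_contMDiff h1 fun z ↦ smul_mem_normalBundle m n (hσ.mem z.2) z.1

variable [IsManifold (𝓡 m) ∞ M]

/-- Surjectivity of the derivative of a map into `M` is an open condition near a local section. -/
lemma eventually_surjective {τ : N → M} (hτ : ContMDiff (𝓡 n) (𝓡 m) ∞ τ)
    (hf : ContMDiff (𝓡 m) (𝓡 n) ∞ f) (hτf : ∀ x, τ (f x) = x) (x : M) :
    ∀ᶠ q in 𝓝 (f x), Function.Surjective (mfderiv (𝓡 n) (𝓡 m) τ q) := by
  set c := extChartAt (𝓡 n) (f x) with hc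
  set d := extChartAt (𝓡 m) x with hd
  set g : EuclideanSpace ℝ (Fin n) → EuclideanSpace ℝ (Fin m) := fun z ↦ d (τ (c.symm z)) with hg
  have hct : ∀ q ∈ c.source, c q ∈ c.target := fun q hq ↦ c.map_source hq
  have hcomp : ∀ z ∈ c.target, ContMDiffAt (𝓡 n) (𝓡 m) ∞ (fun z ↦ τ (c.symm z)) z := fun z hz ↦
    contMDiffAt_comp_extChartAt_symm hz (hτ _)
  have hfx : f x ∈ c.source := mem_extChartAt_source _
  have hgd : ContDiffAt ℝ ∞ g (c (f x)) := by
    refine contDiffAt_extChartAt_comp m (hcomp _ (hct _ hfx)) ?_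
    rw [c.left_inv hfx, hτf]
    exact mem_chart_source _ x
  set L : EuclideanSpace ℝ (Fin m) →L[ℝ] EuclideanSpace ℝ (Fin n) :=
    mfderiv (𝓡 m) (𝓡 n) f x with hL
  have hbase : ∀ q q' : N, q = q' →
      (mfderiv (𝓡 n) (𝓡 m) τ q : EuclideanSpace ℝ (Fin n) →L[ℝ] EuclideanSpace ℝ (Fin m)) =
        mfderiv (𝓡 n) (𝓡 m) τ q' := by rintro q _ rfl; rfl
  have hLid : (fderiv ℝ g (c (f x))).comp L = ContinuousLinearMap.id ℝ _ := by
    have hx : τ (c.symm (c (f x))) ∈ (chartAt (EuclideanSpace ℝ (Fin m)) x).source := by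
      rw [c.left_inv hfx, hτf]
      exact mem_chart_source _ x
    have h1 := mfderiv_eq_chartSymmDeriv_comp m (hcomp _ (hct _ hfx)) hx
    have h2 := mfderiv_comp_extChartAt_symm (hct _ hfx)
      ((hτ (c.symm (c (f x)))).mdifferentiableAt (by simp))
    rw [h2, hbase _ _ (c.left_inv hfx), c.left_inv hfx, hτf, chartSymmDeriv_self,
      chartSymmDeriv_self] at h1
    have h3 : (mfderiv (𝓡 n) (𝓡 m) τ (f x) :
        EuclideanSpace ℝ (Fin n) →L[ℝ] EuclideanSpace ℝ (Fin m)).comp L =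
        ContinuousLinearMap.id ℝ _ := by
      refine (mfderiv_comp x ((hτ (f x)).mdifferentiableAt (by simp))
        ((hf x).mdifferentiableAt (by simp))).symm.trans ?_
      rw [show τ ∘ f = id from funext hτf]
      exact mfderiv_id
    rw [← h3]
    exact congrArg (fun A : EuclideanSpace ℝ (Fin n) →L[ℝ] EuclideanSpace ℝ (Fin m) ↦ A.comp L)
      h1.symm
  -- As `τ ∘ f = id`, the fixed map `L = df_x` is a right inverse of the derivative of `τ` at `f x`.
  -- The determinant of the composition is therefore `1` there and nonzero nearby.
  have hdet : ∀ᶠ q in 𝓝 (f x), ((fderiv ℝ g (c q)).comp L).det ≠ 0 := by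
    have hcont : ContinuousAt (fun q ↦ ((fderiv ℝ g (c q)).comp L).det) (f x) := by
      have h1 : ContinuousAt (fderiv ℝ g) (c (f x)) :=
        (hgd.fderiv_right (m := 0) (by norm_cast)).continuousAt
      have h2 : ContinuousAt (fun q ↦ fderiv ℝ g (c q)) (f x) :=
        ContinuousAt.comp (g := fderiv ℝ g) (f := c) h1 (continuousAt_extChartAt (f x))
      exact ContinuousLinearMap.continuous_det.continuousAt.comp (h2.clm_comp continuousAt_const)
    refine hcont.eventually_ne ?_
    rw [hLid]
    simp [ContinuousLinearMap.det]
  have hsrc : ∀ᶠ q in 𝓝 (f x), τ q ∈ (chartAt (EuclideanSpace ℝ (Fin m)) x).source :=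
    hτ.continuous.continuousAt ((chartAt _ x).open_source.mem_nhds
      (by rw [hτf]; exact mem_chart_source _ x))
  filter_upwards [hdet, hsrc, extChartAt_source_mem_nhds (I := 𝓡 n) (f x)] with q hq hq1 hq2
  have hq3 : c.symm (c q) = q := c.left_inv hq2
  have hq4 : τ (c.symm (c q)) ∈ (chartAt (EuclideanSpace ℝ (Fin m)) x).source := by rwa [hq3]
  have h1 := mfderiv_eq_chartSymmDeriv_comp m (hcomp _ (hct _ hq2)) hq4
  have h2 := mfderiv_comp_extChartAt_symm (hct _ hq2)
    ((hτ (c.symm (c q))).mdifferentiableAt (by simp))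
  have hs : Function.Surjective (fderiv ℝ g (c q)) := by
    have := (LinearMap.equivOfDetNeZero
      (((fderiv ℝ g (c q)).comp L : EuclideanSpace ℝ (Fin m) →L[ℝ] EuclideanSpace ℝ (Fin m)) :
        EuclideanSpace ℝ (Fin m) →ₗ[ℝ] EuclideanSpace ℝ (Fin m)) hq).surjective
    exact Function.Surjective.of_comp (g := L) this
  have hs' : Function.Surjective ((chartSymmDeriv m x (extChartAt (𝓡 m) x (τ (c.symm (c q))))).comp
      (fderiv ℝ g (c q))) :=
    (chartSymmDeriv_surjective ((extChartAt (𝓡 m) x).map_source (by simpa using hq4))).comp hs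
  rw [← h1, h2, hbase _ _ hq3] at hs'
  exact Function.Surjective.of_comp hs'

/-- The projection of `N` onto `M` along the fibres of the normal exponential map is a
submersion. -/
lemma surjective_mfderiv_fst (hσ : IsNormalExpInverse m n f σ)
    (hsmooth : ContMDiffOn ((𝓡 m).prod (𝓡 n).tangent) (𝓡 n) ∞
      (fun P : M × TangentBundle (𝓡 n) N ↦ expMap n P.2) (normalBundle m n f))
    (hf : ContMDiff (𝓡 m) (𝓡 n) ∞ f) (q : N) :
    Function.Surjective (mfderiv (𝓡 n) (𝓡 m) (fun q ↦ (σ q).1) q) := by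
  have hδ := hσ.contMDiff_dilation hsmooth
  have hδr : ∀ r, ContMDiff (𝓡 n) (𝓡 n) ∞ (dilation n σ r) := fun r ↦
    hδ.comp (contMDiff_const.prodMk contMDiff_id)
  -- A dilation by small `r > 0` carries `q` close to the image of `f`, where the projection is
  -- known to be submersive. Dilations are invertible and preserve the projection, so submersivity
  -- passes back to `q`.
  have hcont : Filter.Tendsto (fun r : ℝ ↦ dilation n σ r q) (𝓝[>] 0) (𝓝 (f (σ q).1)) := by
    rw [← hσ.dilation_zero q]
    exact ((hδ.continuous.comp (Continuous.prodMk continuous_id continuous_const)).tendsto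
      (0 : ℝ)).mono_left nhdsWithin_le_nhds
  have hev := hcont.eventually (eventually_surjective hσ.contMDiff_fst hf
    (fun x ↦ by rw [hσ.apply_image]) (σ q).1)
  obtain ⟨r, hr, hr0⟩ := (hev.and self_mem_nhdsWithin).exists
  have hr0 : (r : ℝ) ≠ 0 := ne_of_gt hr0
  have hid : dilation n σ r ∘ dilation n σ r⁻¹ = id := by
    funext q
    simp [hσ.dilation_dilation, hr0, hσ.dilation_one]
  have hid' : dilation n σ r⁻¹ (dilation n σ r q) = q := by
    simp [hσ.dilation_dilation, hr0, hσ.dilation_one]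
  have hs1 : Function.Surjective (mfderiv (𝓡 n) (𝓡 n) (dilation n σ r) q) := by
    have h := mfderiv_comp (dilation n σ r q)
      ((hδr r (dilation n σ r⁻¹ (dilation n σ r q))).mdifferentiableAt (by simp))
      ((hδr r⁻¹ (dilation n σ r q)).mdifferentiableAt (by simp))
    rw [hid, mfderiv_id] at h
    have hs : Function.Surjective
        (mfderiv (𝓡 n) (𝓡 n) (dilation n σ r) (dilation n σ r⁻¹ (dilation n σ r q))) := fun v ↦
      ⟨_, (congrArg (fun A : EuclideanSpace ℝ (Fin n) →L[ℝ] EuclideanSpace ℝ (Fin n) ↦ A v) h).symm⟩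
    rwa [hid'] at hs
  have hcomp : (fun q ↦ (σ q).1) ∘ dilation n σ r = fun q ↦ (σ q).1 := by
    funext q
    simp [hσ.inverse_dilation]
  have h := mfderiv_comp q ((hσ.contMDiff_fst (dilation n σ r q)).mdifferentiableAt (by simp))
      ((hδr r q).mdifferentiableAt (by simp))
  rw [hcomp] at h
  have hs2 := hr.comp hs1
  intro v
  obtain ⟨w, hw⟩ := hs2 v
  exact ⟨w, (congrArg (fun A : EuclideanSpace ℝ (Fin n) →L[ℝ] EuclideanSpace ℝ (Fin m) ↦ A w)
    h).trans hw⟩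

/-- The projection to `M` is constant along each of the curves whose velocities span the fibre
tangent space. -/
lemma fibreTangentSpace_le_ker (hσ : IsNormalExpInverse m n f σ) (q : N) :
    fibreTangentSpace m n f q ≤
      LinearMap.ker (mfderiv (𝓡 n) (𝓡 m) (fun q ↦ (σ q).1) q).toLinearMap := by
  refine Submodule.span_le.2 ?_
  rintro u ⟨x, v, hv, w, hw, hu⟩
  set γ : ℝ → N := fun t : ℝ ↦ expMap n (⟨f x, v + t • w⟩ : TangentBundle (𝓡 n) N) with hγ
  obtain ⟨h1, h2⟩ := (velocity_eq_iff n).1 hu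
  change γ 0 = q at h1
  subst h1
  change mfderiv (𝓡 n) (𝓡 m) (fun q ↦ (σ q).1) (γ 0) u = 0
  have h2 : mfderiv 𝓘(ℝ, ℝ) (𝓡 n) γ 0 (1 : ℝ) = u := h2
  rw [← h2]
  by_cases hd : MDifferentiableAt 𝓘(ℝ, ℝ) (𝓡 n) γ 0
  · have h := mfderiv_comp (0 : ℝ) ((hσ.contMDiff_fst (γ 0)).mdifferentiableAt (by simp)) hd
    have hconst : (fun q ↦ (σ q).1) ∘ γ = fun _ ↦ x := by
      funext t
      have := hσ.inverse_exp _ (mk_mem_normalBundle m n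
        (Submodule.add_mem _ hv (Submodule.smul_mem _ t hw)))
      simp only [Function.comp, hγ]
      rw [this]
    rw [hconst, mfderiv_const] at h
    exact (congrArg (fun A : ℝ →L[ℝ] EuclideanSpace ℝ (Fin m) ↦ A 1) h).symm
  -- No regularity of the curve is needed: without differentiability its velocity is `0` by
  -- convention.
  · rw [mfderiv_zero_of_not_mdifferentiableAt hd]
    exact map_zero (mfderiv (𝓡 n) (𝓡 m) (fun q ↦ (σ q).1) (γ 0))

/-- The projection has surjective derivative and kills the fibre directions; by transversality the
image of `dψ` supplies all the others. -/
lemma surjective_mfderiv_fst_comp (hσ : IsNormalExpInverse m n f σ)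
    (hsmooth : ContMDiffOn ((𝓡 m).prod (𝓡 n).tangent) (𝓡 n) ∞
      (fun P : M × TangentBundle (𝓡 n) N ↦ expMap n P.2) (normalBundle m n f))
    (hf : ContMDiff (𝓡 m) (𝓡 n) ∞ f) {ψ : M → N} (hψ : ContMDiff (𝓡 m) (𝓡 n) ∞ ψ)
    (htr : TransverseToFibres m n f ψ) (y : M) :
    Function.Surjective (mfderiv (𝓡 m) (𝓡 m) (fun y ↦ (σ (ψ y)).1) y) := by
  intro v
  obtain ⟨w, rfl⟩ := hσ.surjective_mfderiv_fst hsmooth hf (ψ y) v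
  have hw : w ∈ LinearMap.range (mfderiv (𝓡 m) (𝓡 n) ψ y).toLinearMap
    ⊔ fibreTangentSpace m n f (ψ y) := htr y ▸ Submodule.mem_top
  obtain ⟨_, ⟨u, rfl⟩, k, hk, rfl⟩ := Submodule.mem_sup.1 hw
  refine ⟨u, ?_⟩
  have h := mfderiv_comp y ((hσ.contMDiff_fst (ψ y)).mdifferentiableAt (by simp))
      ((hψ y).mdifferentiableAt (by simp))
  have hk0 : mfderiv (𝓡 n) (𝓡 m) (fun q ↦ (σ q).1) (ψ y) k = 0 := hσ.fibreTangentSpace_le_ker _ hk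
  refine Eq.trans (congrArg
    (fun A : EuclideanSpace ℝ (Fin m) →L[ℝ] EuclideanSpace ℝ (Fin m) ↦ A u) h) ?_
  refine Eq.symm ((map_add (mfderiv (𝓡 n) (𝓡 m) (fun q ↦ (σ q).1) (ψ y)) _ _).trans ?_)
  rw [hk0]
  exact add_zero _

/-- The projection to `M` of a map transverse to the fibres of the normal exponential map is a
local diffeomorphism. -/
lemma isLocalDiffeomorph_fst_comp (hσ : IsNormalExpInverse m n f σ)
    (hsmooth : ContMDiffOn ((𝓡 m).prod (𝓡 n).tangent) (𝓡 n) ∞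
      (fun P : M × TangentBundle (𝓡 n) N ↦ expMap n P.2) (normalBundle m n f))
    (hf : ContMDiff (𝓡 m) (𝓡 n) ∞ f) {ψ : M → N} (hψ : ContMDiff (𝓡 m) (𝓡 n) ∞ ψ)
    (htr : TransverseToFibres m n f ψ) :
    IsLocalDiffeomorph (𝓡 m) (𝓡 m) ∞ (fun y ↦ (σ (ψ y)).1) :=
  isLocalDiffeomorph_of_mfderiv_surjective (hσ.contMDiff_fst.comp hψ)
    (hσ.surjective_mfderiv_fst_comp hsmooth hf hψ htr)

end IsNormalExpInverse

end Retraction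
end NormalExp
end

noncomputable section


namespace NormalExp

/-! ### Mean curvature tested against a normal vector -/

section MeanCurvature

variable {m n : ℕ}
  {M : Type*} [TopologicalSpace M] [ChartedSpace (EuclideanSpace ℝ (Fin m)) M]
  {N : Type*} [TopologicalSpace N] [ChartedSpace (EuclideanSpace ℝ (Fin n)) N]
  [IsManifold (𝓡 n) ∞ N] [RiemannianBundle (fun x : N ↦ TangentSpace (𝓡 n) x)]

/-- The normal projection is self-adjoint and fixes `T`, so it can be dropped from the second
fundamental form. -/
lemma innerAt_meanCurvature {φ : M → N} {x : M} {T : EuclideanSpace ℝ (Fin n)}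
    (hT : ∀ u, innerAt n (φ x) (mfderiv (𝓡 m) (𝓡 n) φ x u) T = 0) :
    innerAt n (φ x) (meanCurvature m n φ x) T =
      ∑ i, ∑ j, (inducedGram m n φ x (stdFrame m x))⁻¹ i j *
        innerAt n (φ x) (covariantHessian m n φ x (stdFrame m x i) (stdFrame m x j)) T := by
  have : FiniteDimensional ℝ (TangentSpace (𝓡 n) (φ x)) :=
    inferInstanceAs (FiniteDimensional ℝ (EuclideanSpace ℝ (Fin n)))
  have hT' : (normalSpace m n φ x).starProjection (T : TangentSpace (𝓡 n) (φ x)) = T :=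
    Submodule.starProjection_eq_self_iff.2 ((mem_normalSpace_iff m n).2 hT)
  have h1 : ∀ w : TangentSpace (𝓡 n) (φ x),
      innerAt n (φ x) ((normalSpace m n φ x).starProjection w) T = innerAt n (φ x) w T := fun w ↦
    (Submodule.inner_starProjection_left_eq_right (normalSpace m n φ x) w
      (T : TangentSpace (𝓡 n) (φ x))).trans (congrArg (innerAt n (φ x) w) hT')
  refine (sum_inner (𝕜 := ℝ) (E := TangentSpace (𝓡 n) (φ x)) _ _ _).trans ?_
  refine Finset.sum_congr rfl fun i _ ↦ ?_
  refine (innerAt_sum_smul n (φ x) _ _ _ _).trans ?_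
  refine Finset.sum_congr rfl fun j _ ↦ ?_
  rw [secondFundamentalForm]
  exact congrArg (_ * ·) (h1 _)

variable [IsContMDiffRiemannianBundle (𝓡 n) ∞ (EuclideanSpace ℝ (Fin n))
      (fun x : N ↦ TangentSpace (𝓡 n) x)] [IsManifold (𝓡 m) ∞ M]

/-- A minimal map cannot be a graph with mean curvature of constant sign. -/
lemma not_exists_normal_of_meanCurvature_eq_zero {ψ : M → N} (hψ : ContMDiff (𝓡 m) (𝓡 n) ∞ ψ)
    {y : M} (hmean : meanCurvature m n ψ y = 0) {a : EuclideanSpace ℝ (Fin m)}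
    (ha : a = extChartAt (𝓡 m) y y) {φ : EuclideanSpace ℝ (Fin m) → N}
    (hφ : φ = fun z ↦ ψ ((extChartAt (𝓡 m) y).symm z))
    {F : EuclideanSpace ℝ (Fin m) → EuclideanSpace ℝ (Fin n)}
    (hF : F = fun z ↦ extChartAt (𝓡 n) (φ a) (φ z)) :
    ¬ ∃ T : EuclideanSpace ℝ (Fin n),
      (∀ v, metricForm n (φ a) (F a) (fderiv ℝ F a v) T = 0) ∧
      ∑ i : Fin m, ∑ j : Fin m, (Matrix.of fun i j : Fin m ↦ inducedForm n φ
          (EuclideanSpace.single i (1 : ℝ)) (EuclideanSpace.single j (1 : ℝ)) a)⁻¹ i j *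
        metricForm n (φ a) (F a)
          (fderiv ℝ (fderiv ℝ F) a (EuclideanSpace.single i (1 : ℝ)) (EuclideanSpace.single j (1 : ℝ))
            + christoffelForm n (φ a) (F a) (fderiv ℝ F a (EuclideanSpace.single i (1 : ℝ)))
              (fderiv ℝ F a (EuclideanSpace.single j (1 : ℝ)))) T < 0 := by
  rintro ⟨T, hT, hneg⟩
  have hya : (extChartAt (𝓡 m) y).symm a = y := by rw [ha, extChartAt_to_inv]
  have hφa : φ a = ψ y := by rw [hφ]; simp only [hya]
  have hat : a ∈ (extChartAt (𝓡 m) y).target := ha ▸ mem_extChartAt_target y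
  have hFr : F = readInCharts m n ψ y := by
    rw [hF, hφa, hφ]; rfl
  have hFa : F a = extChartAt (𝓡 n) (ψ y) (ψ y) := by rw [hF]; simp only [hφa]
  have hφd : ContMDiffAt (𝓡 m) (𝓡 n) ∞ φ a := by
    rw [hφ]; exact contMDiffAt_comp_extChartAt_symm hat (hψ _)
  have hd : (mfderiv (𝓡 m) (𝓡 n) φ a : EuclideanSpace ℝ (Fin m) →L[ℝ] EuclideanSpace ℝ (Fin n)) =
      mfderiv (𝓡 m) (𝓡 n) ψ y := by
    rw [hφ]
    exact mfderiv_comp_extChartAt_symm_self ha ((hψ y).mdifferentiableAt (by simp))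
  have hdF : (mfderiv (𝓡 m) (𝓡 n) ψ y : EuclideanSpace ℝ (Fin m) →L[ℝ] EuclideanSpace ℝ (Fin n)) =
      fderiv ℝ F a := by
    have h := mfderiv_eq_chartSymmDeriv_comp n hφd (mem_chart_source _ (φ a))
    rw [chartSymmDeriv_self, ContinuousLinearMap.id_comp, ← hF, hd] at h
    exact h
  rw [hφa, hFa] at hT hneg
  -- At the centre of the preferred chart the coordinate metric is the inner product of the tangent
  -- space itself, as in the definition of `meanCurvature`.
  simp only [metricForm_self] at hT hneg
  have h1 := innerAt_meanCurvature (φ := ψ) (x := y) (T := T) fun u ↦ by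
    refine Eq.trans ?_ (hT u)
    rw [← hdF]
    rfl
  have h0 : innerAt n (ψ y) (meanCurvature m n ψ y) T = 0 := by
    rw [hmean]; exact inner_zero_left (𝕜 := ℝ) (E := TangentSpace (𝓡 n) (ψ y)) T
  have hG : (Matrix.of fun i j : Fin m ↦ inducedForm n φ
      (EuclideanSpace.single i (1 : ℝ)) (EuclideanSpace.single j (1 : ℝ)) a) =
      inducedGram m n ψ y (stdFrame m y) := by
    ext i j
    exact innerAt_congr n hφa
      (congrArg (fun A : EuclideanSpace ℝ (Fin m) →L[ℝ] EuclideanSpace ℝ (Fin n) ↦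
        A (EuclideanSpace.single i (1 : ℝ))) hd)
      (congrArg (fun A : EuclideanSpace ℝ (Fin m) →L[ℝ] EuclideanSpace ℝ (Fin n) ↦
        A (EuclideanSpace.single j (1 : ℝ))) hd)
  rw [hG] at hneg
  refine hneg.ne (Eq.trans ?_ (h1.symm.trans h0))
  refine Finset.sum_congr rfl fun i _ ↦ Finset.sum_congr rfl fun j _ ↦ ?_
  rw [covariantHessian, ← hFr, ← ha]
  rfl

end MeanCurvature
end NormalExp
end

noncomputable section


namespace NormalExp

/-! ### Partial derivatives of a family of maps -/

section Slices

variable (n : ℕ) {N : Type*} [TopologicalSpace N] [ChartedSpace (EuclideanSpace ℝ (Fin n)) N]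
  {X : Type*} [NormedAddCommGroup X] [NormedSpace ℝ X]

lemma mfderiv_fst_slice {Φ : ℝ × X → N} {r : ℝ} {z : X}
    (hΦ : MDifferentiableAt 𝓘(ℝ, ℝ × X) (𝓡 n) Φ (r, z)) :
    (mfderiv 𝓘(ℝ, ℝ × X) (𝓡 n) Φ (r, z) ((1 : ℝ), (0 : X)) : EuclideanSpace ℝ (Fin n)) =
      mfderiv 𝓘(ℝ, ℝ) (𝓡 n) (fun s ↦ Φ (s, z)) r (1 : ℝ) := by
  have h1 : HasFDerivAt (fun s : ℝ ↦ (s, z)) ((ContinuousLinearMap.id ℝ ℝ).prod 0) r :=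
    (hasFDerivAt_id r).prodMk (hasFDerivAt_const z r)
  have h := hΦ.hasMFDerivAt.comp r h1.hasMFDerivAt
  have h2 := congrArg (fun A : ℝ →L[ℝ] EuclideanSpace ℝ (Fin n) ↦ A 1) h.mfderiv
  exact h2.symm

lemma mfderiv_snd_slice {Φ : ℝ × X → N} {r : ℝ} {z : X}
    (hΦ : MDifferentiableAt 𝓘(ℝ, ℝ × X) (𝓡 n) Φ (r, z)) (e : X) :
    (mfderiv 𝓘(ℝ, ℝ × X) (𝓡 n) Φ (r, z) ((0 : ℝ), e) : EuclideanSpace ℝ (Fin n)) =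
      mfderiv 𝓘(ℝ, X) (𝓡 n) (fun z ↦ Φ (r, z)) z e := by
  have h1 : HasFDerivAt (fun z : X ↦ (r, z)) ((0 : X →L[ℝ] ℝ).prod (ContinuousLinearMap.id ℝ X)) z :=
    (hasFDerivAt_const r z).prodMk (hasFDerivAt_id z)
  have h := hΦ.hasMFDerivAt.comp z h1.hasMFDerivAt
  have h2 := congrArg (fun A : X →L[ℝ] EuclideanSpace ℝ (Fin n) ↦ A e) h.mfderiv
  exact h2.symm

end Slices

/-! ### The geodesic family through `f` and `ψ` -/

section Radial

variable {m n : ℕ}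
  {M : Type*} [TopologicalSpace M] [ChartedSpace (EuclideanSpace ℝ (Fin m)) M]
  [IsManifold (𝓡 m) ∞ M]
  {N : Type*} [TopologicalSpace N] [T2Space N] [ChartedSpace (EuclideanSpace ℝ (Fin n)) N]
  [IsManifold (𝓡 n) ∞ N] [RiemannianBundle (fun x : N ↦ TangentSpace (𝓡 n) x)]
  [IsContMDiffRiemannianBundle (𝓡 n) ∞ (EuclideanSpace ℝ (Fin n))
      (fun x : N ↦ TangentSpace (𝓡 n) x)]

/-- The squared length of a tangent vector. -/
def normSq (V : TangentBundle (𝓡 n) N) : ℝ := innerAt n V.proj V.2 V.2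

/-- The square is used because it is smooth also at zero vectors; the length itself is needed only
where it is positive. -/
lemma contMDiff_normSq :
    ContMDiff (𝓡 n).tangent 𝓘(ℝ, ℝ) ∞ (normSq : TangentBundle (𝓡 n) N → ℝ) :=
  ContMDiff.inner_bundle (b := fun V : TangentBundle (𝓡 n) N ↦ V.proj)
    (v := fun V ↦ V.2) (w := fun V ↦ V.2) contMDiff_id contMDiff_id

lemma normSq_nonneg (V : TangentBundle (𝓡 n) N) : 0 ≤ normSq V :=
  real_inner_self_nonneg (F := TangentSpace (𝓡 n) V.proj)

lemma eq_zero_of_normSq_eq_zero {V : TangentBundle (𝓡 n) N} (h : normSq V = 0) : V.2 = 0 :=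
  (inner_self_eq_zero (𝕜 := ℝ) (E := TangentSpace (𝓡 n) V.proj)).1 h

lemma normSq_smul (V : TangentBundle (𝓡 n) N) (r : ℝ) :
    normSq (⟨V.proj, r • V.2⟩ : TangentBundle (𝓡 n) N) = r ^ 2 * normSq V := by
  refine (real_inner_smul_left (F := TangentSpace (𝓡 n) V.proj) V.2 (r • V.2) r).trans ?_
  rw [real_inner_smul_right (F := TangentSpace (𝓡 n) V.proj)]
  change r * (r * normSq V) = _
  ring

lemma inv_sqrt_sq_mul {a : ℝ} (ha : 0 < a) : (√a)⁻¹ ^ 2 * a = 1 := by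
  rw [inv_pow, Real.sq_sqrt ha.le, inv_mul_cancel₀ ha.ne']

variable {f : M → N} {σ : N → M × TangentBundle (𝓡 n) N} {ψ : M → N}

/-- The family of dilations of `ψ`, parametrised by the distance to `f`, in the chart at `y`. -/
def radialFamily (σ : N → M × TangentBundle (𝓡 n) N) (ψ : M → N) (y : M)
    (z : ℝ × EuclideanSpace ℝ (Fin m)) : N :=
  IsNormalExpInverse.dilation n σ
    (z.1 * (√(normSq (σ (ψ ((extChartAt (𝓡 m) y).symm z.2))).2))⁻¹)
    (ψ ((extChartAt (𝓡 m) y).symm z.2))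

/-- The part of the chart at `y` where `ψ` does not meet `f`. -/
def radialDomain (σ : N → M × TangentBundle (𝓡 n) N) (ψ : M → N) (y : M) :
    Set (EuclideanSpace ℝ (Fin m)) :=
  (extChartAt (𝓡 m) y).target ∩ (extChartAt (𝓡 m) y).symm ⁻¹' {y | 0 < normSq (σ (ψ y)).2}

lemma contMDiff_normSq_inverse (hσ : IsNormalExpInverse m n f σ) (hψ : ContMDiff (𝓡 m) (𝓡 n) ∞ ψ) :
    ContMDiff (𝓡 m) 𝓘(ℝ, ℝ) ∞ (fun y ↦ normSq (σ (ψ y)).2) :=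
  contMDiff_normSq.comp (hσ.contMDiff_snd.comp hψ)

lemma isOpen_radialDomain (hσ : IsNormalExpInverse m n f σ) (hψ : ContMDiff (𝓡 m) (𝓡 n) ∞ ψ)
    (y : M) : IsOpen (radialDomain (m := m) σ ψ y) :=
  (contMDiffOn_extChartAt_symm_target m y).continuousOn.isOpen_inter_preimage
    (isOpen_extChartAt_target y)
    (isOpen_lt continuous_const (contMDiff_normSq_inverse hσ hψ).continuous)

lemma contMDiffAt_inv_sqrt_normSq (hσ : IsNormalExpInverse m n f σ)
    (hψ : ContMDiff (𝓡 m) (𝓡 n) ∞ ψ) {y : M} (hy : 0 < normSq (σ (ψ y)).2) :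
    ContMDiffAt (𝓡 m) 𝓘(ℝ, ℝ) ∞ (fun y ↦ (√(normSq (σ (ψ y)).2))⁻¹) y := by
  have h : ContDiffAt ℝ ∞ (fun t : ℝ ↦ (√t)⁻¹) (normSq (σ (ψ y)).2) :=
    (contDiffAt_id.sqrt hy.ne').inv (Real.sqrt_pos.2 hy).ne'
  exact ContMDiffAt.comp (I' := 𝓘(ℝ, ℝ)) (g := fun t : ℝ ↦ (√t)⁻¹) y h.contMDiffAt
    (contMDiff_normSq_inverse hσ hψ y)

lemma contMDiffAt_radialFamily (hσ : IsNormalExpInverse m n f σ)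
    (hsmooth : ContMDiffOn ((𝓡 m).prod (𝓡 n).tangent) (𝓡 n) ∞
      (fun P : M × TangentBundle (𝓡 n) N ↦ expMap n P.2) (normalBundle m n f))
    (hψ : ContMDiff (𝓡 m) (𝓡 n) ∞ ψ) (y : M) (r : ℝ) {z : EuclideanSpace ℝ (Fin m)}
    (hz : z ∈ radialDomain σ ψ y) :
    ContMDiffAt 𝓘(ℝ, ℝ × EuclideanSpace ℝ (Fin m)) (𝓡 n) ∞ (radialFamily σ ψ y) (r, z) := by
  have hc : ContMDiffAt 𝓘(ℝ, ℝ × EuclideanSpace ℝ (Fin m)) (𝓡 m) ∞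
      (fun z : ℝ × EuclideanSpace ℝ (Fin m) ↦ (extChartAt (𝓡 m) y).symm z.2) (r, z) :=
    ContMDiffAt.comp (I' := 𝓡 m) (r, z) (((contMDiffOn_extChartAt_symm_target m y) z hz.1).contMDiffAt
      ((isOpen_extChartAt_target y).mem_nhds hz.1)) contDiff_snd.contMDiff.contMDiffAt
  have h1 : ContMDiffAt 𝓘(ℝ, ℝ × EuclideanSpace ℝ (Fin m)) 𝓘(ℝ, ℝ) ∞
      (fun z : ℝ × EuclideanSpace ℝ (Fin m) ↦ z.1 *
        (√(normSq (σ (ψ ((extChartAt (𝓡 m) y).symm z.2))).2))⁻¹) (r, z) :=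
    ContMDiffAt.mul contDiff_fst.contMDiff.contMDiffAt
      (ContMDiffAt.comp (I' := 𝓡 m) (g := fun y ↦ (√(normSq (σ (ψ y)).2))⁻¹) (r, z)
        (contMDiffAt_inv_sqrt_normSq hσ hψ hz.2) hc)
  exact ContMDiffAt.comp (I' := 𝓘(ℝ, ℝ).prod (𝓡 n))
    (g := fun z : ℝ × N ↦ IsNormalExpInverse.dilation n σ z.1 z.2) (r, z)
    (hσ.contMDiff_dilation hsmooth).contMDiffAt (h1.prodMk ((hψ _).comp (r, z) hc))

/-- No positivity is required: where the normal vector vanishes, `V` is zero and the geodesic is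
constant. -/
lemma radialFamily_geodesic (hσ : IsNormalExpInverse m n f σ)
    (hdef : ∀ P ∈ normalBundle m n f, P.2 ∈ expDomain n) (y : M) (z : EuclideanSpace ℝ (Fin m))
    {V : TangentBundle (𝓡 n) N}
    (hV : V = ⟨(σ (ψ ((extChartAt (𝓡 m) y).symm z))).2.proj,
      (√(normSq (σ (ψ ((extChartAt (𝓡 m) y).symm z))).2))⁻¹ •
        (σ (ψ ((extChartAt (𝓡 m) y).symm z))).2.2⟩) :
    IsGeodesic n (fun r ↦ radialFamily σ ψ y (r, z)) ∧
      velocity n (fun r ↦ radialFamily σ ψ y (r, z)) 0 = V := by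
  have hV' : V ∈ expDomain n := hV ▸ hdef _ (smul_mem_normalBundle m n (hσ.mem _) _)
  have h := isGeodesic_expMap_smul n hV'
  have heq : (fun r : ℝ ↦ radialFamily σ ψ y (r, z)) =
      fun r : ℝ ↦ expMap n (⟨V.proj, r • V.2⟩ : TangentBundle (𝓡 n) N) := by
    funext r
    subst hV
    simp only [radialFamily, IsNormalExpInverse.dilation, mul_smul]
  rw [heq]
  exact h

lemma radialFamily_zero (hσ : IsNormalExpInverse m n f σ) (y : M) (z : EuclideanSpace ℝ (Fin m)) :
    radialFamily σ ψ y (0, z) = f (σ (ψ ((extChartAt (𝓡 m) y).symm z))).1 := by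
  rw [radialFamily, zero_mul, hσ.dilation_zero]

lemma radialFamily_self (hσ : IsNormalExpInverse m n f σ) {y : M} {z : EuclideanSpace ℝ (Fin m)}
    (hz : z ∈ radialDomain σ ψ y) :
    radialFamily σ ψ y (√(normSq (σ (ψ ((extChartAt (𝓡 m) y).symm z))).2), z) =
      ψ ((extChartAt (𝓡 m) y).symm z) := by
  rw [radialFamily, mul_inv_cancel₀ (Real.sqrt_pos.2 hz.2).ne', hσ.dilation_one]

/-- At `r = 0` the radial velocity is the normalised vector of `σ ∘ ψ`, a unit normal to `f`, and
the slice factors through `f`, so its derivatives are tangent to `f`. -/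
lemma radialFamily_gauss (hσ : IsNormalExpInverse m n f σ)
    (hsmooth : ContMDiffOn ((𝓡 m).prod (𝓡 n).tangent) (𝓡 n) ∞
      (fun P : M × TangentBundle (𝓡 n) N ↦ expMap n P.2) (normalBundle m n f))
    (hdef : ∀ P ∈ normalBundle m n f, P.2 ∈ expDomain n)
    (hf : ContMDiff (𝓡 m) (𝓡 n) ∞ f) (hψ : ContMDiff (𝓡 m) (𝓡 n) ∞ ψ) (y : M) :
    ∀ r, ∀ z ∈ radialDomain σ ψ y, ∀ e : EuclideanSpace ℝ (Fin m),
      inducedForm n (radialFamily σ ψ y) (1, 0) (0, e) (r, z) = 0 := by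
  have hΦ := fun r z hz ↦ contMDiffAt_radialFamily hσ hsmooth hψ y r (z := z) hz
  have hT : ∀ z ∈ radialDomain σ ψ y,
      (mfderiv 𝓘(ℝ, ℝ × EuclideanSpace ℝ (Fin m)) (𝓡 n) (radialFamily σ ψ y) (0, z)
        ((1 : ℝ), (0 : EuclideanSpace ℝ (Fin m))) : EuclideanSpace ℝ (Fin n)) =
      (√(normSq (σ (ψ ((extChartAt (𝓡 m) y).symm z))).2))⁻¹ •
        (σ (ψ ((extChartAt (𝓡 m) y).symm z))).2.2 := fun z hz ↦ by
    rw [mfderiv_fst_slice n ((hΦ 0 z hz).mdifferentiableAt (by simp))]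
    exact ((velocity_eq_iff n).1 (radialFamily_geodesic hσ hdef y z rfl).2).2
  refine gauss n (isOpen_radialDomain hσ hψ y) hΦ
    (fun z _ ↦ (radialFamily_geodesic hσ hdef y z rfl).1) (fun z hz ↦ ?_) (fun z hz e ↦ ?_)
  · refine (innerAt_congr n ((radialFamily_zero hσ y z).trans (hσ.proj_eq _).symm) (hT z hz)
      (hT z hz)).trans ?_
    exact (normSq_smul _ _).trans (inv_sqrt_sq_mul hz.2)
  · have hslice : (fun z ↦ radialFamily σ ψ y (0, z)) =
        f ∘ fun z ↦ (σ (ψ ((extChartAt (𝓡 m) y).symm z))).1 := funext (radialFamily_zero hσ y)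
    have hd : ContMDiffAt (𝓡 m) (𝓡 m) ∞ (fun z ↦ (σ (ψ ((extChartAt (𝓡 m) y).symm z))).1) z :=
      contMDiffAt_comp_extChartAt_symm (φ := fun y ↦ (σ (ψ y)).1) hz.1
        ((hσ.contMDiff_fst.comp hψ) _)
    have h1 := mfderiv_comp z ((hf _).mdifferentiableAt (by simp)) (hd.mdifferentiableAt (by simp))
    have h2 := mfderiv_snd_slice n ((hΦ 0 z hz).mdifferentiableAt (by simp)) e
    rw [hslice, h1] at h2
    have h3 := ((mem_normalBundle_iff m n).1 (smul_mem_normalBundle m n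
      (hσ.mem (ψ ((extChartAt (𝓡 m) y).symm z)))
      (√(normSq (σ (ψ ((extChartAt (𝓡 m) y).symm z))).2))⁻¹)).2
    refine (inducedForm_comm n _ _ _ _).trans ?_
    exact (innerAt_congr n (radialFamily_zero hσ y z) h2 (hT z hz)).trans (h3 _)

end Radial
end NormalExp
end

noncomputable section


namespace NormalExp

/-! ### The direction of `ψ` as a unit normal field of `f` -/

section UnitNormal

variable {m n : ℕ}
  {M : Type*} [TopologicalSpace M] [ChartedSpace (EuclideanSpace ℝ (Fin m)) M]
  [IsManifold (𝓡 m) ∞ M]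
  {N : Type*} [TopologicalSpace N] [T2Space N] [ChartedSpace (EuclideanSpace ℝ (Fin n)) N]
  [IsManifold (𝓡 n) ∞ N] [RiemannianBundle (fun x : N ↦ TangentSpace (𝓡 n) x)]
  [IsContMDiffRiemannianBundle (𝓡 n) ∞ (EuclideanSpace ℝ (Fin n))
      (fun x : N ↦ TangentSpace (𝓡 n) x)]
  {f : M → N} {σ : N → M × TangentBundle (𝓡 n) N} {ψ : M → N} {β : M → M} {U : Set M}

/-- The direction of `ψ` in the normal bundle of `f`, transported by `β`. -/
def unitNormal (f : M → N) (σ : N → M × TangentBundle (𝓡 n) N) (ψ : M → N) (β : M → M) (x : M) :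
    TangentSpace (𝓡 n) (f x) :=
  ((√(normSq (σ (ψ (β x))).2))⁻¹ • (σ (ψ (β x))).2.2 : EuclideanSpace ℝ (Fin n))

lemma mk_smul_unitNormal (hσ : IsNormalExpInverse m n f σ) {x : M} (hx : (σ (ψ (β x))).1 = x)
    (s : ℝ) :
    (⟨f x, s • unitNormal f σ ψ β x⟩ : TangentBundle (𝓡 n) N) =
      ⟨(σ (ψ (β x))).2.proj,
        (s * (√(normSq (σ (ψ (β x))).2))⁻¹) • (σ (ψ (β x))).2.2⟩ := by
  have h : ∀ (q q' : N) (v : EuclideanSpace ℝ (Fin n)), q = q' →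
      (⟨q, v⟩ : TangentBundle (𝓡 n) N) = ⟨q', v⟩ := by rintro q _ v rfl; rfl
  refine (h _ _ _ ((congrArg f hx).symm.trans (hσ.proj_eq _).symm)).trans ?_
  rw [mul_smul]
  rfl

lemma pushoff_unitNormal (hσ : IsNormalExpInverse m n f σ) {x : M} (hx : (σ (ψ (β x))).1 = x)
    (s : ℝ) :
    pushoff n f (unitNormal f σ ψ β) s x =
      IsNormalExpInverse.dilation n σ (s * (√(normSq (σ (ψ (β x))).2))⁻¹) (ψ (β x)) := by
  rw [pushoff, mk_smul_unitNormal hσ hx]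
  rfl

/-- `β` is a local section of `τ ∘ ψ`: it turns the normal vector attached to a point of the source
of `ψ` into a field over an open set of feet, as the volume hypothesis demands. -/
lemma isUnitNormalOn_unitNormal (hσ : IsNormalExpInverse m n f σ)
    (hψ : ContMDiff (𝓡 m) (𝓡 n) ∞ ψ) (hU : IsOpen U) (hβ : ContMDiffOn (𝓡 m) (𝓡 m) ∞ β U)
    (hβU : ∀ x ∈ U, (σ (ψ (β x))).1 = x) (hpos : ∀ x ∈ U, 0 < normSq (σ (ψ (β x))).2) :
    IsUnitNormalOn m n f U (unitNormal f σ ψ β) := by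
  have hmk : ∀ x ∈ U, (⟨f x, unitNormal f σ ψ β x⟩ : TangentBundle (𝓡 n) N) =
      ⟨(σ (ψ (β x))).2.proj, (√(normSq (σ (ψ (β x))).2))⁻¹ • (σ (ψ (β x))).2.2⟩ := fun x hx ↦ by
    have h := mk_smul_unitNormal hσ (hβU x hx) 1
    rwa [one_smul, one_mul] at h
  refine ⟨hU, fun x hx ↦ ?_, fun x hx ↦ ?_, fun x hx ↦ ?_⟩
  · refine ContMDiffWithinAt.congr (f := fun x ↦ (⟨(σ (ψ (β x))).2.proj,
      (√(normSq (σ (ψ (β x))).2))⁻¹ • (σ (ψ (β x))).2.2⟩ : TangentBundle (𝓡 n) N)) ?_ hmk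
      (hmk x hx)
    have h := contMDiff_smul_tangentBundle.contMDiffAt.comp (β x)
      ((contMDiffAt_inv_sqrt_normSq hσ hψ (hpos x hx)).prodMk
        ((hσ.contMDiff_snd.comp hψ) (β x)))
    exact h.comp_contMDiffWithinAt x (hβ x hx)
  · have h := smul_mem_normalBundle m n (hσ.mem (ψ (β x))) (√(normSq (σ (ψ (β x))).2))⁻¹
    rw [← hmk x hx, hβU x hx] at h
    exact (mem_normalSpace_iff m n).2 ((mem_normalBundle_iff m n).1 h).2
  · have h := congrArg normSq (hmk x hx)
    rw [normSq_smul, inv_sqrt_sq_mul (hpos x hx)] at h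
    have h' : (‖unitNormal f σ ψ β x‖ : ℝ) ^ 2 = 1 :=
      (real_inner_self_eq_norm_sq (F := TangentSpace (𝓡 n) (f x)) _).symm.trans h
    exact (pow_eq_one_iff_of_nonneg (norm_nonneg _) two_ne_zero).1 h'

lemma contMDiffAt_pushoff_unitNormal (hσ : IsNormalExpInverse m n f σ)
    (hsmooth : ContMDiffOn ((𝓡 m).prod (𝓡 n).tangent) (𝓡 n) ∞
      (fun P : M × TangentBundle (𝓡 n) N ↦ expMap n P.2) (normalBundle m n f))
    (hψ : ContMDiff (𝓡 m) (𝓡 n) ∞ ψ) (hU : IsOpen U) (hβ : ContMDiffOn (𝓡 m) (𝓡 m) ∞ β U)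
    (hβU : ∀ x ∈ U, (σ (ψ (β x))).1 = x) (hpos : ∀ x ∈ U, 0 < normSq (σ (ψ (β x))).2)
    (s : ℝ) {x : M} (hx : x ∈ U) :
    ContMDiffAt (𝓡 m) (𝓡 n) ∞ (pushoff n f (unitNormal f σ ψ β) s) x := by
  have h1 : ContMDiffAt (𝓡 m) (𝓡 n) ∞ (fun y ↦ IsNormalExpInverse.dilation n σ
      (s * (√(normSq (σ (ψ y)).2))⁻¹) (ψ y)) (β x) :=
    ContMDiffAt.comp (I' := 𝓘(ℝ, ℝ).prod (𝓡 n))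
      (g := fun z : ℝ × N ↦ IsNormalExpInverse.dilation n σ z.1 z.2) (β x)
      (hσ.contMDiff_dilation hsmooth).contMDiffAt
      ((contMDiffAt_const.mul (contMDiffAt_inv_sqrt_normSq hσ hψ (hpos x hx))).prodMk (hψ _))
  refine (h1.comp x ((hβ x hx).contMDiffAt (hU.mem_nhds hx))).congr_of_eventuallyEq ?_
  filter_upwards [hU.mem_nhds hx] with x' hx'
  exact pushoff_unitNormal hσ (hβU x' hx') s

/-- Near `y` the slice at `s` is the pushoff at distance `s` composed with `τ ∘ ψ`, so the chain
rule relates the two induced metrics. -/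
lemma inducedForm_radialFamily (hσ : IsNormalExpInverse m n f σ)
    (hsmooth : ContMDiffOn ((𝓡 m).prod (𝓡 n).tangent) (𝓡 n) ∞
      (fun P : M × TangentBundle (𝓡 n) N ↦ expMap n P.2) (normalBundle m n f))
    (hψ : ContMDiff (𝓡 m) (𝓡 n) ∞ ψ) (hU : IsOpen U) (hβ : ContMDiffOn (𝓡 m) (𝓡 m) ∞ β U)
    (hβU : ∀ x ∈ U, (σ (ψ (β x))).1 = x) (hpos : ∀ x ∈ U, 0 < normSq (σ (ψ (β x))).2)
    {y : M} (hy : (σ (ψ y)).1 ∈ U) (hyβ : ∀ᶠ y' in 𝓝 y, β (σ (ψ y')).1 = y') (s : ℝ)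
    (u v : EuclideanSpace ℝ (Fin m)) {a : EuclideanSpace ℝ (Fin m)}
    (ha : a = extChartAt (𝓡 m) y y) :
    inducedForm n (radialFamily σ ψ y) (0, u) (0, v) (s, a) =
      innerAt n (pushoff n f (unitNormal f σ ψ β) s (σ (ψ y)).1)
        (mfderiv (𝓡 m) (𝓡 n) (pushoff n f (unitNormal f σ ψ β) s) (σ (ψ y)).1
          (mfderiv (𝓡 m) (𝓡 m) (fun y ↦ (σ (ψ y)).1) y u))
        (mfderiv (𝓡 m) (𝓡 n) (pushoff n f (unitNormal f σ ψ β) s) (σ (ψ y)).1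
          (mfderiv (𝓡 m) (𝓡 m) (fun y ↦ (σ (ψ y)).1) y v)) := by
  set θ := pushoff n f (unitNormal f σ ψ β) s with hθ
  set c := extChartAt (𝓡 m) y with hc
  have hα : ContMDiff (𝓡 m) (𝓡 m) ∞ (fun y ↦ (σ (ψ y)).1) := hσ.contMDiff_fst.comp hψ
  have hat : a ∈ c.target := ha ▸ mem_extChartAt_target y
  have hay : c.symm a = y := by rw [ha]; exact extChartAt_to_inv y
  have hev : ∀ᶠ y' in 𝓝 y, radialFamily σ ψ y (s, c y') = θ (σ (ψ y')).1 := by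
    filter_upwards [hyβ, hα.continuous.continuousAt (hU.mem_nhds hy),
      extChartAt_source_mem_nhds (I := 𝓡 m) y] with y' h1 h2 h3
    have h4 : (extChartAt (𝓡 m) y).symm (c y') = y' := c.left_inv h3
    have h5 := pushoff_unitNormal hσ (hβU _ h2) s
    rw [hθ, h5, radialFamily, h4, h1]
  have hev' : (fun z ↦ radialFamily σ ψ y (s, z)) =ᶠ[𝓝 a] fun z ↦ θ (σ (ψ (c.symm z))).1 := by
    have hcont : ContinuousAt c.symm a := by rw [ha]; exact continuousAt_extChartAt_symm y
    have hev2 : ∀ᶠ y' in 𝓝 (c.symm a), radialFamily σ ψ y (s, c y') = θ (σ (ψ y')).1 := by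
      rwa [hay]
    filter_upwards [hcont.eventually hev2, (isOpen_extChartAt_target y).mem_nhds hat] with z h1 h2
    rwa [c.right_inv h2] at h1
  have hyD : a ∈ radialDomain σ ψ y := by
    refine ⟨hat, ?_⟩
    change 0 < normSq (σ (ψ (c.symm a))).2
    rw [hay]
    have h := hpos _ hy
    rwa [hyβ.self_of_nhds] at h
  have hθd : MDifferentiableAt (𝓡 m) (𝓡 n) θ (σ (ψ y)).1 :=
    (contMDiffAt_pushoff_unitNormal hσ hsmooth hψ hU hβ hβU hpos s hy).mdifferentiableAt (by simp)
  have hαd : MDifferentiableAt (𝓡 m) (𝓡 m) (fun y ↦ (σ (ψ y)).1) y :=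
    (hα y).mdifferentiableAt (by simp)
  have hcomp := mfderiv_comp (f := fun y ↦ (σ (ψ y)).1) y hθd hαd
  have hself := mfderiv_comp_extChartAt_symm_self (φ := fun y ↦ θ (σ (ψ y)).1) ha
    (hθd.comp (f := fun y ↦ (σ (ψ y)).1) y hαd)
  have hval : radialFamily σ ψ y (s, a) = θ (σ (ψ y)).1 := by rw [← hev.self_of_nhds, ← ha]
  have hder : ∀ u : EuclideanSpace ℝ (Fin m),
      (mfderiv 𝓘(ℝ, ℝ × EuclideanSpace ℝ (Fin m)) (𝓡 n) (radialFamily σ ψ y) (s, a)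
        ((0 : ℝ), u) : EuclideanSpace ℝ (Fin n)) =
      mfderiv (𝓡 m) (𝓡 n) θ (σ (ψ y)).1 (mfderiv (𝓡 m) (𝓡 m) (fun y ↦ (σ (ψ y)).1) y u) :=
    fun u ↦ by
    have h1 := mfderiv_snd_slice n
      ((contMDiffAt_radialFamily hσ hsmooth hψ y s hyD).mdifferentiableAt (by simp)) u
    rw [hev'.mfderiv_eq] at h1
    have h2 := congrArg (fun A : EuclideanSpace ℝ (Fin m) →L[ℝ] EuclideanSpace ℝ (Fin n) ↦ A u)
      (hself.trans hcomp)
    exact h1.trans h2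
  exact innerAt_congr n hval (hder u) (hder v)

end UnitNormal
end NormalExp
end

noncomputable section


namespace NormalExp

/-! ### The maximum principle -/

section MaximumPrinciple

variable {m n : ℕ}
  {M : Type*} [TopologicalSpace M] [ChartedSpace (EuclideanSpace ℝ (Fin m)) M]
  [IsManifold (𝓡 m) ∞ M]
  {N : Type*} [TopologicalSpace N] [T2Space N] [ChartedSpace (EuclideanSpace ℝ (Fin n)) N]
  [IsManifold (𝓡 n) ∞ N] [RiemannianBundle (fun x : N ↦ TangentSpace (𝓡 n) x)]
  [IsContMDiffRiemannianBundle (𝓡 n) ∞ (EuclideanSpace ℝ (Fin n))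
      (fun x : N ↦ TangentSpace (𝓡 n) x)]
  {f : M → N} {σ : N → M × TangentBundle (𝓡 n) N} {ψ : M → N}

/-- Transfers the volume hypothesis from pushoffs of `f` to the radial family, by means of a local
inverse of `τ ∘ ψ` near `y`. -/
lemma deriv_volume_radialFamily_pos (hσ : IsNormalExpInverse m n f σ)
    (hsmooth : ContMDiffOn ((𝓡 m).prod (𝓡 n).tangent) (𝓡 n) ∞
      (fun P : M × TangentBundle (𝓡 n) N ↦ expMap n P.2) (normalBundle m n f))
    (hvol : VolumeStrictlyIncreasing m n f)
    (hf : ContMDiff (𝓡 m) (𝓡 n) ∞ f) (hψ : ContMDiff (𝓡 m) (𝓡 n) ∞ ψ)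
    (htr : TransverseToFibres m n f ψ) {y : M} (hy : 0 < normSq (σ (ψ y)).2)
    {a : EuclideanSpace ℝ (Fin m)} (ha : a = extChartAt (𝓡 m) y y) {r : ℝ} (hr : 0 < r) :
    0 < deriv (fun s ↦ √(Matrix.of fun i j : Fin m ↦ inducedForm n (radialFamily σ ψ y)
      (0, EuclideanSpace.single i 1) (0, EuclideanSpace.single j 1) (s, a)).det) r := by
  obtain ⟨Φ, hyΦ, hΦ⟩ := hσ.isLocalDiffeomorph_fst_comp hsmooth hf hψ htr y
  have hβ : ContMDiffOn (𝓡 m) (𝓡 m) ∞ Φ.symm Φ.target := Φ.contMDiffOn_invFun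
  set U := Φ.target ∩ Φ.symm ⁻¹' {y | 0 < normSq (σ (ψ y)).2} with hU
  have hUo : IsOpen U := hβ.continuousOn.isOpen_inter_preimage Φ.open_target
    (isOpen_lt continuous_const (contMDiff_normSq_inverse hσ hψ).continuous)
  have hβU : ∀ x ∈ U, (σ (ψ (Φ.symm x))).1 = x := fun x hx ↦
    (hΦ (Φ.map_target hx.1)).trans (Φ.right_inv hx.1)
  have hΦy : ∀ y' ∈ Φ.source, Φ.symm (σ (ψ y')).1 = y' := fun y' hy' ↦
    (congrArg Φ.symm (hΦ hy')).trans (Φ.left_inv hy')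
  have hyU : (σ (ψ y)).1 ∈ U := by
    refine ⟨?_, ?_⟩
    · have h : (σ (ψ y)).1 = Φ y := hΦ hyΦ
      rw [h]
      exact Φ.map_source hyΦ
    · change 0 < normSq (σ (ψ (Φ.symm (σ (ψ y)).1))).2
      rwa [hΦy y hyΦ]
  have hβ' : ContMDiffOn (𝓡 m) (𝓡 m) ∞ Φ.symm U := hβ.mono Set.inter_subset_left
  have hpos : ∀ x ∈ U, 0 < normSq (σ (ψ (Φ.symm x))).2 := fun x hx ↦ hx.2
  have hη := isUnitNormalOn_unitNormal hσ hψ hUo hβ' hβU hpos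
  let A : EuclideanSpace ℝ (Fin m) →L[ℝ] EuclideanSpace ℝ (Fin m) :=
    mfderiv (𝓡 m) (𝓡 m) (fun y ↦ (σ (ψ y)).1) y
  have hA : Function.Surjective A := hσ.surjective_mfderiv_fst_comp hsmooth hf hψ htr y
  let L : EuclideanSpace ℝ (Fin m) ≃ₗ[ℝ] EuclideanSpace ℝ (Fin m) :=
    LinearEquiv.ofBijective A.toLinearMap ⟨LinearMap.injective_iff_surjective.2 hA, hA⟩
  -- The image of the coordinate basis under the isomorphism `d(τ ∘ ψ)`. The volume hypothesis holds
  -- for every basis, and this one makes the Gram matrices coincide.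
  let e : Module.Basis (Fin m) ℝ (TangentSpace (𝓡 m) (σ (ψ y)).1) :=
    (EuclideanSpace.basisFun (Fin m) ℝ).toBasis.map L
  have hb : ∀ i, (EuclideanSpace.basisFun (Fin m) ℝ).toBasis i = EuclideanSpace.single i 1 :=
    fun i ↦ by simp
  have he : ∀ i, e i = A (EuclideanSpace.single i 1) := fun i ↦
    (Module.Basis.map_apply _ L i).trans (congrArg A (hb i))
  have h := hvol U _ hη _ hyU e r hr
  have heq : (fun s ↦ volumeForm m n (pushoff n f (unitNormal f σ ψ Φ.symm) s) (σ (ψ y)).1 e) =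
      fun s ↦ √(Matrix.of fun i j : Fin m ↦ inducedForm n (radialFamily σ ψ y)
        (0, EuclideanSpace.single i 1) (0, EuclideanSpace.single j 1) (s, a)).det := by
    funext s
    rw [volumeForm, inducedGram]
    congr 3
    ext i j
    rw [he i, he j, inducedForm_radialFamily hσ hsmooth hψ hUo hβ' hβU hpos hyU
      (Filter.mem_of_superset (Φ.open_source.mem_nhds hyΦ) hΦy) s _ _ ha]
    rfl
  rwa [heq] at h

/-- At a positive local maximum the length is smooth and `ψ` is its graph in the radial family. The
comparison with the slice then gives a normal vector having negative product with the mean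
curvature. -/
lemma normSq_inverse_eq_zero_of_isLocalMax (hσ : IsNormalExpInverse m n f σ)
    (hdef : ∀ P ∈ normalBundle m n f, P.2 ∈ expDomain n)
    (hsmooth : ContMDiffOn ((𝓡 m).prod (𝓡 n).tangent) (𝓡 n) ∞
      (fun P : M × TangentBundle (𝓡 n) N ↦ expMap n P.2) (normalBundle m n f))
    (hvol : VolumeStrictlyIncreasing m n f)
    (hf : ContMDiff (𝓡 m) (𝓡 n) ∞ f) (hψ : ContMDiff (𝓡 m) (𝓡 n) ∞ ψ)
    (htr : TransverseToFibres m n f ψ) {y : M} (hmean : meanCurvature m n ψ y = 0)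
    (hmax : IsLocalMax (fun y ↦ normSq (σ (ψ y)).2) y) : normSq (σ (ψ y)).2 = 0 := by
  by_contra hne
  have hy : 0 < normSq (σ (ψ y)).2 := (normSq_nonneg _).lt_of_ne' hne
  set a := extChartAt (𝓡 m) y y with ha
  have hya : (extChartAt (𝓡 m) y).symm a = y := extChartAt_to_inv y
  have haB : a ∈ radialDomain σ ψ y := by
    refine ⟨mem_extChartAt_target y, ?_⟩
    change 0 < normSq (σ (ψ ((extChartAt (𝓡 m) y).symm a))).2
    rwa [hya]
  have hB := isOpen_radialDomain hσ hψ y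
  set ρ : EuclideanSpace ℝ (Fin m) → ℝ :=
    fun z ↦ √(normSq (σ (ψ ((extChartAt (𝓡 m) y).symm z))).2) with hρ
  have hc : ContMDiffAt (𝓡 m) (𝓡 m) ∞ (extChartAt (𝓡 m) y).symm a :=
    ((contMDiffOn_extChartAt_symm_target m y) a haB.1).contMDiffAt
      ((isOpen_extChartAt_target y).mem_nhds haB.1)
  have hρd : ContDiffAt ℝ 2 ρ a := by
    have h := ((contMDiff_normSq_inverse hσ hψ) _).comp a hc
    exact (h.contDiffAt.of_le (by norm_cast)).sqrt haB.2.ne'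
  have hρmax : IsLocalMax ρ a := by
    have h : ∀ᶠ z in 𝓝 a, normSq (σ (ψ ((extChartAt (𝓡 m) y).symm z))).2 ≤ normSq (σ (ψ y)).2 :=
      hc.continuousAt.eventually (by rw [hya]; exact hmax)
    filter_upwards [h] with z hz
    change √_ ≤ √_
    rw [hya]
    exact Real.sqrt_le_sqrt hz
  have hρa : 0 < ρ a := Real.sqrt_pos.2 haB.2
  set φ : EuclideanSpace ℝ (Fin m) → N := fun z ↦ ψ ((extChartAt (𝓡 m) y).symm z) with hφ
  have hφd : ∀ᶠ z in 𝓝 a, ContMDiffAt (𝓡 m) (𝓡 n) ∞ φ z :=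
    Filter.mem_of_superset (hB.mem_nhds haB)
      fun z hz ↦ contMDiffAt_comp_extChartAt_symm hz.1 (hψ _)
  have hφρ : φ =ᶠ[𝓝 a] fun z ↦ radialFamily σ ψ y (ρ z, z) :=
    Filter.mem_of_superset (hB.mem_nhds haB) fun z hz ↦ (radialFamily_self hσ hz).symm
  have hex := exists_normal_of_deriv_volume_pos n hB
    (fun r z hz ↦ contMDiffAt_radialFamily hσ hsmooth hψ y r hz)
    (radialFamily_gauss hσ hsmooth hdef hf hψ y) haB hρd hρmax hφd hφρ
    (fun i ↦ EuclideanSpace.single i 1)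
    (deriv_volume_radialFamily_pos hσ hsmooth hvol hf hψ htr hy ha hρa) rfl
  exact not_exists_normal_of_meanCurvature_eq_zero hψ hmean ha hφ rfl hex

/-- A minimal immersion transverse to the fibres factors through `f`. -/
lemma eq_comp_of_isMinimalImmersion [CompactSpace M] (hσ : IsNormalExpInverse m n f σ)
    (hdef : ∀ P ∈ normalBundle m n f, P.2 ∈ expDomain n)
    (hsmooth : ContMDiffOn ((𝓡 m).prod (𝓡 n).tangent) (𝓡 n) ∞
      (fun P : M × TangentBundle (𝓡 n) N ↦ expMap n P.2) (normalBundle m n f))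
    (hvol : VolumeStrictlyIncreasing m n f)
    (hf : ContMDiff (𝓡 m) (𝓡 n) ∞ f) (hψ : ContMDiff (𝓡 m) (𝓡 n) ∞ ψ)
    (htr : TransverseToFibres m n f ψ) (hmean : ∀ y, meanCurvature m n ψ y = 0) :
    ψ = f ∘ fun y ↦ (σ (ψ y)).1 := by
  funext y
  -- The squared length is nonnegative and its global maximum is `0`, hence it vanishes everywhere.
  obtain ⟨y₀, -, hy₀⟩ := isCompact_univ.exists_isMaxOn ⟨y, Set.mem_univ y⟩
    (contMDiff_normSq_inverse hσ hψ).continuous.continuousOn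
  have h0 := normSq_inverse_eq_zero_of_isLocalMax hσ hdef hsmooth hvol hf hψ htr (hmean y₀)
    (Filter.Eventually.of_forall fun z ↦ hy₀ (Set.mem_univ z))
  have h1 : normSq (σ (ψ y)).2 = 0 :=
    le_antisymm ((hy₀ (Set.mem_univ y)).trans_eq h0) (normSq_nonneg _)
  have h2 := hσ.exp_inverse (ψ y)
  have h3 : (σ (ψ y)).2 = ⟨(σ (ψ y)).2.proj, 0⟩ := by
    rw [← eq_zero_of_normSq_eq_zero h1]
  rw [h3, expMap_zero, hσ.proj_eq] at h2
  exact h2.symm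

end MaximumPrinciple

/-! ### Open self-maps of compact spaces -/

section Coverings

variable {X : Type*} [TopologicalSpace X] [CompactSpace X] [T2Space X]

/-- The image is open, and closed because it is compact. -/
lemma surjective_of_isOpenMap_of_connectedSpace [ConnectedSpace X] {α : X → X}
    (hα : Continuous α) (ho : IsOpenMap α) : Function.Surjective α := by
  have h : IsClopen (Set.range α) := ⟨(isCompact_range hα).isClosed, ho.isOpen_range⟩
  exact Set.range_eq_univ.1 (h.eq_univ (Set.range_nonempty α))

lemma image_connectedComponent_of_isOpenMap [LocallyConnectedSpace X] {α : X → X}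
    (hα : Continuous α) (ho : IsOpenMap α) (x : X) :
    α '' connectedComponent x = connectedComponent (α x) := by
  refine (hα.image_connectedComponent_subset x).antisymm ?_
  exact IsClopen.connectedComponent_subset
    ⟨((isClosed_connectedComponent.isCompact).image hα).isClosed, ho _ isOpen_connectedComponent⟩
    ⟨x, mem_connectedComponent, rfl⟩

/-- Each component is mapped onto a whole component, and injectivity makes the induced map on
components injective. There are finitely many components, by compactness and local connectedness, so
every one is reached. -/
lemma surjective_of_isOpenMap_of_injective [LocallyConnectedSpace X] {α : X → X}
    (hα : Continuous α) (ho : IsOpenMap α) (hi : Function.Injective α) :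
    Function.Surjective α := by
  have : Finite (ConnectedComponents X) := inferInstance
  have hcc : ∀ x, connectedComponent (α x) = α '' connectedComponent x := fun x ↦
    (image_connectedComponent_of_isOpenMap hα ho x).symm
  have hinj : Function.Injective hα.connectedComponentsMap := by
    rintro ⟨x⟩ ⟨y⟩ h
    have h' : connectedComponent (α x) = connectedComponent (α y) :=
      ConnectedComponents.coe_eq_coe.1 h
    rw [hcc, hcc] at h'
    exact ConnectedComponents.coe_eq_coe.2 (hi.image_injective h')
  intro z
  obtain ⟨⟨x⟩, hx⟩ := Finite.surjective_of_injective hinj (z : ConnectedComponents X)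
  have hz : connectedComponent (α x) = connectedComponent z := ConnectedComponents.coe_eq_coe.1 hx
  obtain ⟨x', -, h⟩ : z ∈ α '' connectedComponent x := by
    rw [← hcc, hz]; exact mem_connectedComponent
  exact ⟨x', h⟩

end Coverings

end NormalExp
end

/-! ### The main theorem -/

theorem mainTheorem11 {m n : ℕ}
    {N : Type*} [EMetricSpace N] [ChartedSpace (EuclideanSpace ℝ (Fin n)) N]
    [IsManifold (𝓡 n) ∞ N]
    [RiemannianBundle (fun x : N ↦ TangentSpace (𝓡 n) x)]
    [IsContMDiffRiemannianBundle (𝓡 n) ∞ (EuclideanSpace ℝ (Fin n))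
      (fun x : N ↦ TangentSpace (𝓡 n) x)]
    [IsRiemannianManifold (𝓡 n) N] [CompleteSpace N]
    {M : Type*} [TopologicalSpace M] [ChartedSpace (EuclideanSpace ℝ (Fin m)) M]
    [IsManifold (𝓡 m) ∞ M] [CompactSpace M]
    (f : M → N) (hf_emb : IsSmoothEmbedding (𝓡 m) (𝓡 n) ∞ f)
    (hf_min : NormalExp.IsMinimalImmersion m n f)
    (hf_exp : NormalExp.NormalExpIsDiffeo m n f)
    (hf_vol : NormalExp.VolumeStrictlyIncreasing m n f) :
    (NormalExp.IsMinimalImmersion m n f ∧ NormalExp.TransverseToFibres m n f f) ∧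
    ∀ ψ : M → N, NormalExp.IsMinimalImmersion m n ψ → NormalExp.TransverseToFibres m n f ψ →
      ∃ α : M → M, IsLocalDiffeomorph (𝓡 m) (𝓡 m) ∞ α ∧ ψ = f ∘ α ∧
        (ConnectedSpace M → Function.Surjective α) ∧
        (Function.Injective ψ → Function.Bijective α) := by
  have hf : ContMDiff (𝓡 m) (𝓡 n) ∞ f := hf_emb.contMDiff
  -- The Hausdorff property of `M` is inherited from `N` through the embedding.
  have : T2Space M := hf_emb.isEmbedding.t2Space
  have : LocallyConnectedSpace M :=
    ChartedSpace.locallyConnectedSpace (EuclideanSpace ℝ (Fin m)) M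
  obtain ⟨hdef, hsmooth, σ, hσ₁, hσ₂, hσ₃, hσ₄⟩ := hf_exp
  have hσ : NormalExp.IsNormalExpInverse m n f σ := ⟨hσ₁, hσ₂, hσ₃, hσ₄⟩
  refine ⟨⟨hf_min, NormalExp.transverseToFibres_self m n hdef⟩, fun ψ hψ_min htr ↦ ?_⟩
  have hψ : ContMDiff (𝓡 m) (𝓡 n) ∞ ψ := hψ_min.isImmersion.contMDiff
  have hα := hσ.isLocalDiffeomorph_fst_comp hsmooth hf hψ htr
  have hψα := NormalExp.eq_comp_of_isMinimalImmersion hσ hdef hsmooth hf_vol hf hψ htr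
    hψ_min.meanCurvature_eq_zero
  have hcont := hα.contMDiff.continuous
  refine ⟨_, hα, hψα, fun _ ↦
    NormalExp.surjective_of_isOpenMap_of_connectedSpace hcont hα.isOpenMap, fun hinj ↦ ?_⟩
  have hαinj : Function.Injective fun y ↦ (σ (ψ y)).1 := by
    rw [hψα] at hinj
    exact hinj.of_comp
  exact ⟨hαinj, NormalExp.surjective_of_isOpenMap_of_injective hcont hα.isOpenMap hαinj⟩
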